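/- Let $d\ge 1$ be an integer, $\gamma\ge 1$ and $0<\alpha<\pi/2$ real numbers, $H_0=-\Delta$ in $L^2(\mathbb R^d)$ with domain $H^2(\mathbb R^d)$, $\mathscr S_\alpha=\{z\in\mathbb C:|\Im z|<\alpha\}$ and $\mathbb C^{\pm}=\{z\in\mathbb C:\pm\Im z>0\}$. Let $V:\mathbb R^d\to\mathbb C$ be dilation analytic on $\mathscr S_\alpha$, that is: (a) $V\in L^{\gamma+d/2}(\mathbb R^d;\mathbb C)$; (b) the multiplication operator $V$ satisfies $\mathcal D(V)\supset H^2(\mathbb R^d)$, and $V(H_0+1)^{-1}$ is compact on $L^2(\mathbb R^d)$; (c) the function $\theta\mapsto V_\theta:=V(e^{\theta}\,\cdot\,)$, $\theta\in\mathbb R$, has an analytic continuation to $\mathscr S_\alpha$, still denoted $V_\theta$, with values in $L^{\gamma+d/2}(\mathbb R^d;\mathbb C)$; (d) the function $\theta\mapsto V_\theta(H_0+1)^{-1}$, $\theta\in\mathbb R$, extends to an analytic function on $\mathscr S_\alpha$ with values in the bounded operators on $L^2(\mathbb R^d)$. Put $H=H_0+V$ and, for $\theta\in\mathscr S_\alpha$,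 $H(\theta)=e^{-2\theta}H_0+V_\theta$, both with domain $H^2(\mathbb R^d)$. For an operator $T$ let $\sigma_{\rm d}(T)$ be the set of those eigenvalues $\lambda$ of $T$ that are isolated points of the spectrum $\sigma(T)$ and have finite algebraic multiplicity $\sup_{k\in\mathbb N}\dim\ker[(T-\lambda)^k]$. Then, for the upper sign throughout and for the lower sign throughout: if $\theta\in\mathscr S_\alpha\cap\mathbb C^{\pm}$ and $\lambda\in\mathbb C^{\pm}$, then $$\lambda\in\sigma_{\rm d}(H)\iff\lambda\in\sigma_{\rm d}(H(\theta)).$$ -/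

import Mathlib

open MeasureTheory Filter Topology
open scoped ENNReal Laplacian

noncomputable section

/-! ### Closed-operator notions: spectrum, algebraic multiplicity, discrete spectrum -/

section Spectrum

variable {X : Type*} [NormedAddCommGroup X] [NormedSpace ℂ X]

/-- `z` is in the resolvent set of the (unbounded) operator `T`: the map `T - z : D(T) → X` is
a bijection with bounded inverse `R`. -/
def IsResolventPoint (T : X →ₗ.[ℂ] X) (z : ℂ) : Prop :=
  ∃ R : X →L[ℂ] X,
    (∀ f : X, ∃ h : R f ∈ T.domain, T ⟨R f, h⟩ - z • R f = f) ∧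
    (∀ u : T.domain, R (T u - z • (u : X)) = u)

/-- The spectrum `σ(T)`: the complement of the resolvent set. -/
def operatorSpectrum (T : X →ₗ.[ℂ] X) : Set ℂ :=
  {z | ¬ IsResolventPoint T z}

/-- `z` is an eigenvalue of `T`. -/
def IsOperatorEigenvalue (T : X →ₗ.[ℂ] X) (z : ℂ) : Prop :=
  ∃ u : T.domain, (u : X) ≠ 0 ∧ T u = z • (u : X)

/-- `ker ((T - z) ^ k)`, on the natural domain of the power: `u` is in the kernel of the
`(k + 1)`-st power iff `u ∈ D(T)` and `(T - z) u` is in the kernel of the `k`-th power. -/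
def powerKernel (T : X →ₗ.[ℂ] X) (z : ℂ) : ℕ → Submodule ℂ X
  | 0 => ⊥
  | k + 1 => ((powerKernel T z k).comap (T.toFun - z • T.domain.subtype)).map T.domain.subtype

/-- The algebraic multiplicity `sup_k dim ker ((T - z) ^ k)`, in `ℕ ∪ {∞}`. -/
def algebraicMultiplicity (T : X →ₗ.[ℂ] X) (z : ℂ) : ℕ∞ :=
  ⨆ k : ℕ, Cardinal.toENat (Module.rank ℂ (powerKernel T z k))

/-- The discrete spectrum `σ_d(T)`: the eigenvalues of `T` which are isolated points of `σ(T)`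
and have finite algebraic multiplicity. -/
def discreteSpectrum (T : X →ₗ.[ℂ] X) : Set ℂ :=
  {z | IsOperatorEigenvalue T z ∧ (∀ᶠ w in 𝓝[≠] z, w ∉ operatorSpectrum T) ∧
    algebraicMultiplicity T z < ⊤}

end Spectrum

/-! ### Schrödinger operators in `L²(ℝᵈ)` -/

/-- `ℝᵈ` with its Euclidean structure. -/
abbrev Space (d : ℕ) : Type := EuclideanSpace ℝ (Fin d)

/-- `L²(ℝᵈ; ℂ)`. -/
abbrev L2Space (d : ℕ) : Type := Lp ℂ 2 (volume : Measure (Space d))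

/-- The Sobolev space `H²(ℝᵈ)`, as a subspace of `L²(ℝᵈ)`. -/
def sobolevTwo (d : ℕ) : Submodule ℂ (L2Space d) where
  carrier := {u | TemperedDistribution.MemSobolev 2 2 (Lp.toTemperedDistribution u)}
  add_mem' {u v} hu hv := by
    simpa only [← Lp.toTemperedDistributionCLM_apply, map_add, Set.mem_ofPred_eq] using hu.add hv
  zero_mem' := by
    simp only [← Lp.toTemperedDistributionCLM_apply, map_zero, Set.mem_ofPred_eq]
    exact TemperedDistribution.memSobolev_fun_zero _ _ _ _
  smul_mem' c u hu := by
    simpa only [← Lp.toTemperedDistributionCLM_apply, map_smul, Set.mem_ofPred_eq] using hu.smul c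

theorem toTemperedDistribution_injective {d : ℕ} {u v : L2Space d}
    (h : Lp.toTemperedDistribution u = Lp.toTemperedDistribution v) : u = v :=
  LinearMap.ker_eq_bot.mp
    (Lp.ker_toTemperedDistributionCLM_eq_bot (F := ℂ) (μ := (volume : Measure (Space d)))
      (p := 2)) h

theorem exists_laplacian {d : ℕ} (u : sobolevTwo d) :
    ∃ v : L2Space d, Lp.toTemperedDistribution v = -Δ (Lp.toTemperedDistribution (u : L2Space d)) := by
  have h := TemperedDistribution.MemSobolev.laplacian u.2
  rw [sub_self, TemperedDistribution.memSobolev_zero_iff] at h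
  obtain ⟨v, hv⟩ := h
  refine ⟨-v, ?_⟩
  rw [hv, ← Lp.toTemperedDistributionCLM_apply, map_neg, Lp.toTemperedDistributionCLM_apply]

/-- The free Hamiltonian `H₀ = -Δ` in `L²(ℝᵈ)` with domain `H²(ℝᵈ)`; `H₀ u` is the element of
`L²` which represents the distribution `-Δ u`. -/
def freeHamiltonian (d : ℕ) : L2Space d →ₗ.[ℂ] L2Space d where
  domain := sobolevTwo d
  toFun :=
    { toFun := fun u => (exists_laplacian u).choose
      map_add' := fun u v => by
        apply toTemperedDistribution_injective
        rw [(exists_laplacian (u + v)).choose_spec, ← Lp.toTemperedDistributionCLM_apply (_ + _),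
          map_add, Lp.toTemperedDistributionCLM_apply, Lp.toTemperedDistributionCLM_apply,
          (exists_laplacian u).choose_spec, (exists_laplacian v).choose_spec,
          ← Lp.toTemperedDistributionCLM_apply, ← TemperedDistribution.laplacianCLM_apply,
          Submodule.coe_add, map_add, map_add, neg_add]
        simp
      map_smul' := fun c u => by
        apply toTemperedDistribution_injective
        rw [(exists_laplacian (c • u)).choose_spec, ← Lp.toTemperedDistributionCLM_apply (_ • _),
          RingHom.id_apply, map_smul, Lp.toTemperedDistributionCLM_apply,
          (exists_laplacian u).choose_spec,
          ← Lp.toTemperedDistributionCLM_apply, ← TemperedDistribution.laplacianCLM_apply,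
          Submodule.coe_smul, map_smul, map_smul, smul_neg]
        simp }

theorem freeHamiltonian_spec {d : ℕ} (u : (freeHamiltonian d).domain) :
    Lp.toTemperedDistribution (freeHamiltonian d u) =
      -Δ (Lp.toTemperedDistribution (u : L2Space d)) :=
  (exists_laplacian u).choose_spec

theorem memLp_mul_add {d : ℕ} {W : Space d → ℂ} {u v : L2Space d}
    (hu : MemLp (fun x => W x * u x) 2 volume) (hv : MemLp (fun x => W x * v x) 2 volume) :
    MemLp (fun x => W x * (u + v : L2Space d) x) 2 volume := by
  refine (hu.add hv).ae_eq ?_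
  filter_upwards [Lp.coeFn_add u v] with x hx
  rw [hx]
  exact (mul_add _ _ _).symm

theorem memLp_mul_smul {d : ℕ} {W : Space d → ℂ} (c : ℂ) {u : L2Space d}
    (hu : MemLp (fun x => W x * u x) 2 volume) :
    MemLp (fun x => W x * (c • u : L2Space d) x) 2 volume := by
  refine (hu.const_smul c).ae_eq ?_
  filter_upwards [Lp.coeFn_smul c u] with x hx
  simp only [hx, Pi.smul_apply, smul_eq_mul]
  ring

/-- The maximal multiplication operator by the function `W`:
`D(W) = {u ∈ L² : W u ∈ L²}`, `u ↦ W u`. -/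
def multiplicationOperator {d : ℕ} (W : Space d → ℂ) : L2Space d →ₗ.[ℂ] L2Space d where
  domain :=
    { carrier := {u | MemLp (fun x => W x * u x) 2 volume}
      add_mem' := fun hu hv => memLp_mul_add hu hv
      zero_mem' := by
        refine (MemLp.zero (ε := ℂ)).ae_eq ?_
        filter_upwards [Lp.coeFn_zero ℂ 2 (volume : Measure (Space d))] with x hx
        rw [hx]
        simp
      smul_mem' := fun c _ hu => memLp_mul_smul c hu }
  toFun :=
    { toFun := fun u => MemLp.toLp (fun x => W x * (u : L2Space d) x) u.2
      map_add' := fun u v => by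
        rw [← MemLp.toLp_add]
        apply MemLp.toLp_congr
        filter_upwards [Lp.coeFn_add (u : L2Space d) (v : L2Space d)] with x hx
        rw [Submodule.coe_add, hx]
        exact mul_add _ _ _
      map_smul' := fun c u => by
        rw [RingHom.id_apply, ← MemLp.toLp_const_smul]
        apply MemLp.toLp_congr
        filter_upwards [Lp.coeFn_smul c (u : L2Space d)] with x hx
        simp only [Submodule.coe_smul, hx, Pi.smul_apply, smul_eq_mul]
        ring }

/-- The Schrödinger operator `H = H₀ + V`, on the domain `D(H₀) ∩ D(V)` of the operator sum
(this is `H²(ℝᵈ)` when `D(V) ⊇ D(H₀)`). -/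
def schrodingerOperator {d : ℕ} (V : Space d → ℂ) : L2Space d →ₗ.[ℂ] L2Space d :=
  freeHamiltonian d + multiplicationOperator V

/-- The dilated operator `H(θ) = e^{-2θ} H₀ + V_θ`, where `Vθ` is the function `V_θ`. -/
def dilatedSchrodingerOperator {d : ℕ} (θ : ℂ) (Vθ : Space d → ℂ) :
    L2Space d →ₗ.[ℂ] L2Space d :=
  Complex.exp (-2 * θ) • freeHamiltonian d + multiplicationOperator Vθ

/-! ### Dilation analytic potentials -/

/-- The open strip `{z : |Im z| < α}`. -/
def dilationStrip (α : ℝ) : Set ℂ :=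
  {z | |z.im| < α}

/-- The exponent `γ + d / 2`. -/
def potentialExponent (d : ℕ) (γ : ℝ) : ℝ≥0∞ :=
  ENNReal.ofReal (γ + d / 2)

instance fact_one_le_potentialExponent (d : ℕ) (γ : ℝ) [hγ : Fact (1 ≤ γ)] :
    Fact (1 ≤ potentialExponent d γ) :=
  ⟨ENNReal.one_le_ofReal.mpr (le_add_of_le_of_nonneg hγ.out (by positivity))⟩

/-- The real dilation `x ↦ V (e^t x)`, `t ∈ ℝ`. -/
def realDilation {d : ℕ} (V : Space d → ℂ) (t : ℝ) : Space d → ℂ :=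
  fun x => V (Real.exp t • x)

/-- `K` is the bounded operator `W (H₀ + 1)⁻¹`: every `u ∈ H²(ℝᵈ)` is in `D(W)`, and
`K f = W u` for `f = (H₀ + 1) u`. (`H₀ + 1` maps `H²(ℝᵈ)` bijectively onto `L²(ℝᵈ)`.) -/
def IsResolventProduct {d : ℕ} (W : Space d → ℂ) (K : L2Space d →L[ℂ] L2Space d) : Prop :=
  ∀ u : (freeHamiltonian d).domain, ∃ h : (u : L2Space d) ∈ (multiplicationOperator W).domain,
    K (freeHamiltonian d u + u) = multiplicationOperator W ⟨u, h⟩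

/-- `F` is an analytic continuation of `θ ↦ V_θ` from the real line to the strip, with values in
`L^{γ + d/2}(ℝᵈ; ℂ)`. -/
structure IsDilationContinuation {d : ℕ} (γ α : ℝ) [Fact (1 ≤ γ)] (V : Space d → ℂ)
    (F : ℂ → Lp ℂ (potentialExponent d γ) (volume : Measure (Space d))) : Prop where
  analytic : AnalyticOnNhd ℂ F (dilationStrip α)
  eq_real : ∀ t : ℝ, F (t : ℂ) =ᵐ[volume] realDilation V t

/-- `V` is a dilation analytic complex potential on the strip of half-width `α`. -/
structure IsDilationAnalytic {d : ℕ} (γ α : ℝ) [Fact (1 ≤ γ)] (V : Space d → ℂ) : Prop where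
  /-- `V ∈ L^{γ + d/2}(ℝᵈ; ℂ)`. -/
  memLp : MemLp V (potentialExponent d γ) volume
  /-- `V` is `H₀`-compact. -/
  relCompact : ∃ K : L2Space d →L[ℂ] L2Space d, IsResolventProduct V K ∧ IsCompactOperator K
  /-- `θ ↦ V_θ` continues analytically to the strip as an `L^{γ + d/2}`-valued function. -/
  continuation : ∃ F, IsDilationContinuation γ α V F
  /-- `θ ↦ V_θ (H₀ + 1)⁻¹` continues analytically to the strip as a `B(L²)`-valued function. -/
  resolvent : ∃ G : ℂ → (L2Space d →L[ℂ] L2Space d),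
    AnalyticOnNhd ℂ G (dilationStrip α) ∧
      ∀ t : ℝ, IsResolventProduct (realDilation V t) (G (t : ℂ))

end

/-! This is the Aguilar–Balslev–Combes argument, phrased through a Birman–Schwinger operator. When z
lies off the ray e^{-2θ}[0,∞), H(θ) - z = (1 + B_θ(z))(e^{-2θ}H₀ - z), where B_θ(z) = V_θ(e^{-2θ}H₀
- z)⁻¹ = e^{2θ} V_θ(H₀+1)⁻¹ · (H₀+1)(H₀ - e^{2θ}z)⁻¹. The operators B_θ(z) are compact and analytic
in z and in θ. For 0 ≤ ±Im θ < α < π/2 the ray misses the whole half-plane ±Im z > 0.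

Fix θ. By the analytic Fredholm theorem in z, λ in this half-plane is in σ_d(H(θ)) exactly when 1 +
B_θ(λ) is not invertible (`IsFredholmFactorization.mem_discreteSpectrum_iff`). This needs one point
z₁ at which 1 + B_θ is invertible. Such a point exists for θ = 0 far from the real axis
(`exists_isUnit_one_add_mul_shiftedResolvent`).

It remains to see that invertibility of 1 + B_θ(λ) does not depend on θ
(`birmanSchwinger_compact_and_isUnit_iff`). Real dilations intertwine B_θ(λ) and B_{θ+s}(λ), first
for real θ and then, by the identity theorem, for complex θ. If 1 + B is invertible at θ₁, the
Fredholm theorem in the variable θ makes it invertible on a punctured neighbourhood of θ₂, hence at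
some θ₂ + s with s real, and therefore at the conjugate operator at θ₂. The same fact carries z₁
from θ = 0 to θ.

The L^{γ+d/2} continuation of V and the operator continuation of V_θ(H₀+1)⁻¹ are separate data;
`isResolventProduct_continuation` shows that they are compatible at complex θ. -/

noncomputable section

/-! ### Analytic Fredholm theory in Hilbert spaces -/

section Fredholm

variable {X : Type*} [NormedAddCommGroup X] [InnerProductSpace ℂ X] [CompleteSpace X]

-- Take E spanned by an ε-net of the image of the unit ball: the orthogonal projection onto E is the
-- nearest point, so it moves no K x by more than ε.
omit [CompleteSpace X] in
theorem IsCompactOperator.exists_norm_sub_starProjection_le {K : X →L[ℂ] X}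
    (hK : IsCompactOperator K) {ε : ℝ} (hε : 0 < ε) :
    ∃ (E : Submodule ℂ X) (_ : FiniteDimensional ℂ E),
      ‖K - E.starProjection ∘L K‖ ≤ ε := by
  have hcomp := hK.isCompact_closure_image_closedBall (f := (K : X →ₗ[ℂ] X)) 1
  obtain ⟨t, ht, hcov⟩ := Metric.totallyBounded_iff.mp hcomp.totallyBounded ε hε
  have : FiniteDimensional ℂ (Submodule.span ℂ t) := FiniteDimensional.span_of_finite ℂ ht
  refine ⟨Submodule.span ℂ t, inferInstance, ?_⟩
  refine ContinuousLinearMap.opNorm_le_of_unit_norm hε.le fun x hx => ?_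
  have hx' : K x ∈ closure ((K : X →ₗ[ℂ] X) '' Metric.closedBall 0 1) :=
    subset_closure ⟨x, by simp [hx], rfl⟩
  obtain ⟨y, hy, hxy⟩ := Set.mem_iUnion₂.mp (hcov hx')
  rw [Metric.mem_ball, dist_eq_norm] at hxy
  have hm := Submodule.starProjection_minimal (U := Submodule.span ℂ t) (K x)
  simp only [sub_apply, ContinuousLinearMap.comp_apply]
  rw [hm]
  refine (ciInf_le ⟨0, ?_⟩ (⟨y, Submodule.subset_span hy⟩ : Submodule.span ℂ t)).trans hxy.le
  rintro _ ⟨z, rfl⟩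
  positivity

/-- The inverse of 1 + ab is 1 - a(1 + ba)⁻¹b. With E finite-dimensional this reduces a finite-rank
perturbation on the large space to a determinant. -/
theorem ContinuousLinearMap.isUnit_one_add_comp_of {E Y : Type*}
    [NormedAddCommGroup E] [NormedSpace ℂ E] [NormedAddCommGroup Y] [NormedSpace ℂ Y]
    (a : E →L[ℂ] Y) (b : Y →L[ℂ] E) (h : IsUnit (1 + b ∘L a)) : IsUnit (1 + a ∘L b) := by
  obtain ⟨u, hu⟩ := h
  have h1 : ∀ x, (↑u⁻¹ : E →L[ℂ] E) x + b (a ((↑u⁻¹ : E →L[ℂ] E) x)) = x := fun x => by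
    have := congrArg (fun f : E →L[ℂ] E => f x) u.mul_inv
    simpa [hu] using this
  have h2 : ∀ x, (↑u⁻¹ : E →L[ℂ] E) x + (↑u⁻¹ : E →L[ℂ] E) (b (a x)) = x := fun x => by
    have := congrArg (fun f : E →L[ℂ] E => f x) u.inv_mul
    simpa [hu] using this
  refine ⟨⟨1 + a ∘L b, 1 - a ∘L (↑u⁻¹ : E →L[ℂ] E) ∘L b, ?_, ?_⟩, rfl⟩
  · ext x
    have := congrArg a (h1 (b x))
    simp only [map_add] at this
    simp only [mul_apply_eq_comp, add_apply,
      one_apply_eq_self, sub_apply,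
      ContinuousLinearMap.comp_apply, map_sub]
    rw [← this]; abel
  · ext x
    have := congrArg a (h2 (b x))
    rw [map_add] at this
    simp only [mul_apply_eq_comp, add_apply,
      one_apply_eq_self, sub_apply,
      ContinuousLinearMap.comp_apply, map_add]
    linear_combination (norm := module) -this

theorem ContinuousLinearMap.isUnit_one_add_comp_comm {E Y : Type*}
    [NormedAddCommGroup E] [NormedSpace ℂ E] [NormedAddCommGroup Y] [NormedSpace ℂ Y]
    (a : E →L[ℂ] Y) (b : Y →L[ℂ] E) : IsUnit (1 + a ∘L b) ↔ IsUnit (1 + b ∘L a) :=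
  ⟨isUnit_one_add_comp_of b a, isUnit_one_add_comp_of a b⟩

theorem AnalyticAt.ringInverse {A : Type*} [NormedRing A] [NormedAlgebra ℂ A] [CompleteSpace A]
    {f : ℂ → A} {z : ℂ} (hf : AnalyticAt ℂ f z) (hu : IsUnit (f z)) :
    AnalyticAt ℂ (fun w => Ring.inverse (f w)) z := by
  obtain ⟨u, hu⟩ := hu
  have := analyticAt_inverse (𝕜 := ℂ) u
  rw [hu] at this
  exact this.comp hf

/-- Invertibility of an analytic family of operators on a finite-dimensional space. -/
theorem AnalyticAt.eventually_not_isUnit_or_eventually_isUnit {E : Type*}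
    [NormedAddCommGroup E] [NormedSpace ℂ E] [FiniteDimensional ℂ E] {f : ℂ → E →L[ℂ] E} {z₀ : ℂ}
    (hf : AnalyticAt ℂ f z₀) :
    (∀ᶠ z in 𝓝 z₀, ¬ IsUnit (f z)) ∨ ∀ᶠ z in 𝓝[≠] z₀, IsUnit (f z) := by
  let b := Module.finBasis ℂ E
  have hiff : ∀ g : E →L[ℂ] E, IsUnit g ↔ (LinearMap.toMatrix b b (g : E →ₗ[ℂ] E)).det ≠ 0 := by
    intro g
    rw [LinearMap.det_toMatrix, ← isUnit_iff_ne_zero, ← LinearMap.isUnit_iff_isUnit_det,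
      ContinuousLinearMap.isUnit_iff_bijective, Module.End.isUnit_iff]
    rfl
  -- The determinant is a scalar analytic function, so it vanishes identically near z₀ or has an
  -- isolated zero there at most.
  have han : AnalyticAt ℂ (fun z => (LinearMap.toMatrix b b (f z : E →ₗ[ℂ] E)).det) z₀ := by
    simp only [Matrix.det_apply]
    refine Finset.analyticAt_fun_sum _ fun σ _ => ?_
    refine AnalyticAt.const_smul (Finset.analyticAt_fun_prod _ fun i _ => ?_)
    simp only [LinearMap.toMatrix_apply]
    let ℓ : (E →L[ℂ] E) →L[ℂ] ℂ :=
      (LinearMap.toContinuousLinearMap (b.coord (σ i))) ∘L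
        (ContinuousLinearMap.apply ℂ E (b i))
    exact (ℓ.analyticAt _).comp hf
  rcases han.eventually_eq_zero_or_eventually_ne_zero with h | h
  · left
    filter_upwards [h] with z hz
    rw [hiff]
    exact not_not.mpr hz
  · right
    filter_upwards [h] with z hz
    rwa [hiff]

/-- Local form of the analytic Fredholm theorem. -/
theorem AnalyticAt.eventually_not_isUnit_one_add_or {K : ℂ → X →L[ℂ] X} {z₀ : ℂ}
    (hK : AnalyticAt ℂ K z₀) (hc : IsCompactOperator (K z₀)) :
    (∀ᶠ z in 𝓝 z₀, ¬ IsUnit (1 + K z)) ∨ ∀ᶠ z in 𝓝[≠] z₀, IsUnit (1 + K z) := by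
  obtain ⟨E, hE, hle⟩ := hc.exists_norm_sub_starProjection_le (ε := 1 / 2) (by norm_num)
  let p : X →L[ℂ] E := E.orthogonalProjectionOnto
  let ι : E →L[ℂ] X := E.subtypeL
  set L : X →L[ℂ] X := E.starProjection ∘L K z₀
  -- L has finite rank and Q is close to 1 near z₀, so 1 + K = Q + L = Q(1 + Q⁻¹L). Swapping the
  -- factors of Q⁻¹L yields the family `f` on E.
  let Q : ℂ → X →L[ℂ] X := fun z => 1 + (K z - L)
  have hQ : AnalyticAt ℂ Q z₀ := analyticAt_const.add (hK.sub analyticAt_const)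
  have hQ0 : IsUnit (Q z₀) := by
    have : ‖-(K z₀ - L)‖ < 1 := by rw [norm_neg]; linarith
    have h := isUnit_one_sub_of_norm_lt_one this
    rwa [sub_neg_eq_add] at h
  have hQu : ∀ᶠ z in 𝓝 z₀, IsUnit (Q z) :=
    hQ.continuousAt.eventually (Units.isOpen.mem_nhds hQ0)
  let f : ℂ → E →L[ℂ] E := fun z => 1 + (p ∘L K z₀) ∘L (Ring.inverse (Q z) ∘L ι)
  have hf : AnalyticAt ℂ f z₀ := by
    have h1 := hQ.ringInverse hQ0
    have h2 : AnalyticAt ℂ (fun z => (p ∘L K z₀) ∘L (Ring.inverse (Q z) ∘L ι)) z₀ :=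
      (ContinuousLinearMap.analyticAt ((ContinuousLinearMap.compL ℂ E X E (p ∘L K z₀)) ∘L
        ((ContinuousLinearMap.compL ℂ E X X).flip ι)) _).comp h1
    exact analyticAt_const.add h2
  have key : ∀ᶠ z in 𝓝 z₀, (IsUnit (1 + K z) ↔ IsUnit (f z)) := by
    filter_upwards [hQu] with z hz
    have h1 : 1 + K z = Q z * (1 + (Ring.inverse (Q z) ∘L ι) ∘L (p ∘L K z₀)) := by
      have h2 : (Ring.inverse (Q z) ∘L ι) ∘L (p ∘L K z₀) = Ring.inverse (Q z) * L := rfl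
      rw [h2, mul_add, mul_one, ← mul_assoc, Ring.mul_inverse_cancel _ hz, one_mul]
      simp [Q, add_assoc]
    rw [h1, ← hz.unit_spec, Units.isUnit_units_mul, hz.unit_spec,
      ContinuousLinearMap.isUnit_one_add_comp_comm]
  rcases hf.eventually_not_isUnit_or_eventually_isUnit with h | h
  · left
    filter_upwards [h, key] with z h1 h2
    rwa [h2]
  · right
    filter_upwards [h, key.filter_mono nhdsWithin_le_nhds] with z h1 h2
    rwa [h2]

/-- The analytic Fredholm theorem: if `1 + K z` is invertible somewhere in the domain, then it is
invertible in a punctured neighbourhood of every point of the domain. -/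
theorem AnalyticOnNhd.eventually_isUnit_one_add {K : ℂ → X →L[ℂ] X} {S : Set ℂ}
    (hK : AnalyticOnNhd ℂ K S) (hS : IsPreconnected S) (hc : ∀ z ∈ S, IsCompactOperator (K z))
    {z₁ : ℂ} (hz₁ : z₁ ∈ S) (hu : IsUnit (1 + K z₁)) {z : ℂ} (hz : z ∈ S) :
    ∀ᶠ w in 𝓝[≠] z, IsUnit (1 + K w) := by
  -- By the local alternative the open sets A and B cover S, and they are disjoint; connectedness
  -- leaves only B, which contains z₁.
  let A : Set ℂ := {z | ∀ᶠ w in 𝓝 z, ¬ IsUnit (1 + K w)}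
  let B : Set ℂ := {z | ∀ᶠ w in 𝓝[≠] z, IsUnit (1 + K w)}
  have hA : IsOpen A := isOpen_setOfPred_eventually_nhds
  have hB : IsOpen B := by
    refine isOpen_iff_mem_nhds.mpr fun x hx => ?_
    obtain ⟨u, hu, hxu, h⟩ := mem_nhdsWithin.mp hx
    refine Filter.mem_of_superset (hu.mem_nhds hxu) fun y hy => ?_
    rcases eq_or_ne y x with rfl | hne
    · exact hx
    · exact Filter.Eventually.filter_mono nhdsWithin_le_nhds
        (Filter.mem_of_superset ((hu.inter isOpen_compl_singleton).mem_nhds ⟨hy, hne⟩) h)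
  have hcov : S ⊆ A ∪ B := fun x hx =>
    (hK x hx).eventually_not_isUnit_one_add_or (hc x hx)
  by_contra hcon
  have hzA : z ∈ A := (hcov hz).resolve_right hcon
  have hz₁B : z₁ ∈ B := (hcov hz₁).resolve_left fun h => h.self_of_nhds hu
  obtain ⟨x, -, hxA, hxB⟩ := hS A B hA hB hcov ⟨z, hz, hzA⟩ ⟨z₁, hz₁, hz₁B⟩
  obtain ⟨w, h1, h2⟩ := ((hxA.filter_mono nhdsWithin_le_nhds).and hxB).exists
  exact h1 h2

theorem IsCompactOperator.exists_ker_of_not_isUnit {K : X →L[ℂ] X} (hK : IsCompactOperator K)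
    (h : ¬ IsUnit (1 + K)) : ∃ g : X, g ≠ 0 ∧ g + K g = 0 := by
  have hK' : IsCompactOperator (-K) := hK.neg
  rcases hK'.hasEigenvalue_or_mem_resolventSet (one_ne_zero (α := ℂ)) with h1 | h1
  · obtain ⟨g, hg⟩ := h1.exists_hasEigenvector
    refine ⟨g, hg.2, ?_⟩
    have := hg.apply_eq_smul
    simp at this
    nth_rw 1 [← this]
    simp
  · exact absurd (by simpa [spectrum.mem_resolventSet_iff] using h1) h

/-- A family of operators analytic on a connected set and compact on a set with an accumulation
point is compact everywhere. -/
theorem AnalyticOnNhd.isCompactOperator_of_frequently {K : ℂ → X →L[ℂ] X} {S : Set ℂ}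
    (hK : AnalyticOnNhd ℂ K S) (hS : IsPreconnected S) {z₀ : ℂ} (hz₀ : z₀ ∈ S)
    (hc : ∃ᶠ z in 𝓝[≠] z₀, IsCompactOperator (K z)) {z : ℂ} (hz : z ∈ S) :
    IsCompactOperator (K z) := by
  let C : Submodule ℂ (X →L[ℂ] X) := compactOperator (RingHom.id ℂ) X X
  have hC : IsClosed (C : Set (X →L[ℂ] X)) := isClosed_setOfPred_isCompactOperator
  -- Compact operators form a closed subspace, so compactness is the vanishing of an analytic
  -- function with values in the quotient, and the identity theorem applies.
  let q : (X →L[ℂ] X) →L[ℂ] ((X →L[ℂ] X) ⧸ C) := C.mkQL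
  have hq : ∀ T, q T = 0 ↔ IsCompactOperator T := fun T => Submodule.Quotient.mk_eq_zero C
  have h := AnalyticOnNhd.eqOn_zero_of_preconnected_of_frequently_eq_zero
    (fun w hw => (q.analyticAt _).comp (hK w hw) : AnalyticOnNhd ℂ (q ∘ K) S) hS hz₀
    (hc.mono fun w hw => (hq _).mpr hw) hz
  exact (hq _).mp h

end Fredholm

/-! ### Discrete spectrum of operators with a Fredholm factorization -/

theorem ContinuousLinearMap.map_circleIntegral {E F : Type*} [NormedAddCommGroup E]
    [NormedSpace ℂ E] [CompleteSpace E] [NormedAddCommGroup F] [NormedSpace ℂ F] [CompleteSpace F]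
    (L : E →L[ℂ] F) {f : ℂ → E} {c : ℂ} {r : ℝ} (hf : CircleIntegrable f c r) :
    L (∮ z in C(c, r), f z) = ∮ z in C(c, r), L (f z) := by
  rw [circleIntegral, circleIntegral, ← L.intervalIntegral_comp_comm hf.out]
  simp only [map_smul]

section Factorization

variable {X : Type*} [NormedAddCommGroup X] [InnerProductSpace ℂ X] [CompleteSpace X]

/-- On `S`, `(T - z) R(z) = 1 + K(z)` with `R(z)` a bijection onto the domain of `T` and `K(z)`
compact, both analytic in `z`. -/
structure IsFredholmFactorization (T : X →ₗ.[ℂ] X) (S : Set ℂ) (R K : ℂ → X →L[ℂ] X) : Prop where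
  isOpen : IsOpen S
  isPreconnected : IsPreconnected S
  analytic_left : AnalyticOnNhd ℂ R S
  analytic_right : AnalyticOnNhd ℂ K S
  compact : ∀ z ∈ S, IsCompactOperator (K z)
  mem_domain : ∀ z ∈ S, ∀ f, ∃ h : R z f ∈ T.domain, T ⟨R z f, h⟩ - z • R z f = f + K z f
  surj : ∀ z ∈ S, ∀ u : T.domain, ∃ g, R z g = u
  inj : ∀ z ∈ S, ∀ g, R z g = 0 → g = 0

namespace IsFredholmFactorization

variable {T : X →ₗ.[ℂ] X} {S : Set ℂ} {R K : ℂ → X →L[ℂ] X}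

theorem left_inverse (h : IsFredholmFactorization T S R K) {z : ℂ} (hz : z ∈ S)
    (hu : IsUnit (1 + K z)) (u : T.domain) :
    R z (Ring.inverse (1 + K z) (T u - z • (u : X))) = u := by
  obtain ⟨g, hg⟩ := h.surj z hz u
  obtain ⟨hm, he⟩ := h.mem_domain z hz g
  have hu' : u = ⟨R z g, hm⟩ := Subtype.ext hg.symm
  have h1 := congrArg (fun A : X →L[ℂ] X => A g) (Ring.inverse_mul_cancel _ hu)
  simp only [mul_apply_eq_comp, one_apply_eq_self, add_apply] at h1
  rw [hu', he, h1]

theorem isResolventPoint (h : IsFredholmFactorization T S R K) {z : ℂ} (hz : z ∈ S)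
    (hu : IsUnit (1 + K z)) : IsResolventPoint T z := by
  refine ⟨R z ∘L Ring.inverse (1 + K z), fun f => ?_, fun u => h.left_inverse hz hu u⟩
  obtain ⟨hm, he⟩ := h.mem_domain z hz (Ring.inverse (1 + K z) f)
  refine ⟨hm, he.trans ?_⟩
  have h1 := congrArg (fun A : X →L[ℂ] X => A f) (Ring.mul_inverse_cancel _ hu)
  simpa using h1

theorem isOperatorEigenvalue_iff (h : IsFredholmFactorization T S R K) {z : ℂ} (hz : z ∈ S) :
    IsOperatorEigenvalue T z ↔ ¬ IsUnit (1 + K z) := by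
  constructor
  · rintro ⟨u, hu0, hu⟩ hunit
    have := h.left_inverse hz hunit u
    rw [hu, sub_self, map_zero, map_zero] at this
    exact hu0 this.symm
  · intro hunit
    obtain ⟨g, hg0, hg⟩ := (h.compact z hz).exists_ker_of_not_isUnit hunit
    obtain ⟨hm, he⟩ := h.mem_domain z hz g
    refine ⟨⟨R z g, hm⟩, fun h0 => hg0 (h.inj z hz g h0), ?_⟩
    rw [hg, sub_eq_zero] at he
    exact he

/-- All N k lie in a single eigenspace of a compact operator for a nonzero eigenvalue, which is
finite-dimensional. -/
theorem iSup_toENat_rank_lt_top {P : X →L[ℂ] X} (hP : IsCompactOperator P) {c : ℂ} (hc : c ≠ 0)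
    (N : ℕ → Submodule ℂ X) (hN : ∀ k, ∀ u ∈ N k, P u = c • u) :
    (⨆ k : ℕ, Cardinal.toENat (Module.rank ℂ (N k))) < ⊤ := by
  have hfin := ContinuousLinearMap.finite_dimensional_eigenspace hP c hc
  have hle : ∀ k, N k ≤ Module.End.eigenspace (P : X →ₗ[ℂ] X) c := fun k u hu =>
    Module.End.mem_eigenspace_iff.mpr (hN k u hu)
  refine lt_of_le_of_lt (iSup_le fun k => ?_)
    (ENat.natCast_lt_top (Module.finrank ℂ (Module.End.eigenspace (P : X →ₗ[ℂ] X) c)))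
  rw [← Cardinal.toENat_nat, Module.finrank_eq_rank]
  exact Cardinal.toENat.monotone' (Submodule.rank_mono (hle k))

/-- Up to the factor -2πi, P below is the Riesz projection, the integral of the resolvent over a
small circle around z. It is compact and acts as the scalar -2πi on every power kernel, which bounds
all of them at once. -/
theorem algebraicMultiplicity_lt_top (h : IsFredholmFactorization T S R K) {z₁ : ℂ} (hz₁ : z₁ ∈ S)
    (hu : IsUnit (1 + K z₁)) {z : ℂ} (hz : z ∈ S) : algebraicMultiplicity T z < ⊤ := by
  have hev := h.analytic_right.eventually_isUnit_one_add h.isPreconnected h.compact hz₁ hu hz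
  obtain ⟨δ, hδ, hball⟩ := Metric.mem_nhds_iff.mp
    (inter_mem (h.isOpen.mem_nhds hz) (eventually_nhdsWithin_iff.mp hev))
  set r : ℝ := δ / 2
  have hr0 : 0 < r := half_pos hδ
  have hcb : Metric.closedBall z r ⊆ Metric.ball z δ :=
    Metric.closedBall_subset_ball (half_lt_self hδ)
  have hS : Metric.closedBall z r ⊆ S := fun w hw => (hball (hcb hw)).1
  have hne : ∀ w ∈ Metric.sphere z r, w ≠ z := fun w hw => by
    rintro rfl
    simp [hr0.ne] at hw
  have hsS : Metric.sphere z r ⊆ S := Metric.sphere_subset_closedBall.trans hS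
  have hunit : ∀ w ∈ Metric.sphere z r, IsUnit (1 + K w) := fun w hw =>
    (hball (hcb (Metric.sphere_subset_closedBall hw))).2 (hne w hw)
  let J : ℂ → X →L[ℂ] X := fun w => Ring.inverse (1 + K w)
  have hRc : ContinuousOn R (Metric.sphere z r) := h.analytic_left.continuousOn.mono hsS
  have hKc : ContinuousOn K (Metric.sphere z r) := h.analytic_right.continuousOn.mono hsS
  have hJc : ContinuousOn J (Metric.sphere z r) := fun w hw =>
    (AnalyticAt.ringInverse (analyticAt_const.add (h.analytic_right w (hsS hw)))
      (hunit w hw)).continuousAt.continuousWithinAt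
  have hRJ : ContinuousOn (fun w => R w * J w) (Metric.sphere z r) := hRc.mul hJc
  have hRJi : CircleIntegrable (fun w => R w * J w) z r := hRJ.circleIntegrable hr0.le
  let P : X →L[ℂ] X := ∮ w in C(z, r), R w * J w
  -- Modulo compact operators (1 + K)⁻¹ is 1, so P is congruent to the integral of R, which vanishes
  -- by Cauchy because R is analytic on the whole disc, centre included.
  have hP : IsCompactOperator P := by
    let C : Submodule ℂ (X →L[ℂ] X) := compactOperator (RingHom.id ℂ) X X
    have hC : IsClosed (C : Set (X →L[ℂ] X)) := isClosed_setOfPred_isCompactOperator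
    let q : (X →L[ℂ] X) →L[ℂ] ((X →L[ℂ] X) ⧸ C) := C.mkQL
    have hq : ∀ A, q A = 0 ↔ IsCompactOperator A := fun A => Submodule.Quotient.mk_eq_zero C
    have hR0 : (∮ w in C(z, r), R w) = 0 :=
      Complex.circleIntegral_eq_zero_of_differentiable_on_off_countable hr0.le
        Set.countable_empty (h.analytic_left.continuousOn.mono hS)
        fun w hw => (h.analytic_left w
          (hS (Metric.ball_subset_closedBall hw.1))).differentiableAt
    rw [← hq]
    calc q P = ∮ w in C(z, r), q (R w * J w) := q.map_circleIntegral hRJi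
      _ = ∮ w in C(z, r), q (R w) := by
        refine circleIntegral.integral_congr hr0.le fun w hw => ?_
        have h1 : R w * J w - R w = -(R w * (K w * J w)) := by
          have := Ring.mul_inverse_cancel _ (hunit w hw)
          rw [add_mul, one_mul] at this
          have h2 : J w = 1 - K w * J w := eq_sub_of_add_eq this
          nth_rw 1 [h2]
          rw [mul_sub, mul_one]; abel
        have h3 : q (R w * J w - R w) = 0 := by
          rw [hq, h1]
          exact (((h.compact w (hsS hw)).comp_clm (J w)).clm_comp (R w)).neg
        rwa [map_sub, sub_eq_zero] at h3
      _ = q (∮ w in C(z, r), R w) :=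
        (q.map_circleIntegral (hRc.circleIntegrable hr0.le)).symm
      _ = 0 := by rw [hR0, map_zero]
  have happ : ∀ u : X, ContinuousOn (fun w => (R w * J w) u) (Metric.sphere z r) := fun u =>
    hRJ.clm_apply continuousOn_const
  have hpow : ∀ m : ℤ, ContinuousOn (fun w : ℂ => (w - z) ^ m) (Metric.sphere z r) := fun m =>
    (continuousOn_id.sub continuousOn_const).zpow₀ m fun w hw =>
      Or.inl (sub_ne_zero.mpr (hne w hw))
  -- With v = (T - z)u, the resolvent satisfies (T - w)⁻¹u = (w - z)⁻¹((T - w)⁻¹v - u). Lowering k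
  -- thus raises the power of (w - z)⁻¹, hence the claim for all n; only n = 0 meets the nonzero
  -- integral of (w - z)⁻¹.
  have hstep : ∀ k, ∀ u ∈ powerKernel T z k, ∀ n : ℕ,
      (∮ w in C(z, r), (w - z) ^ (-(n : ℤ)) • (R w * J w) u) =
        if n = 0 then (-(2 * Real.pi * Complex.I) : ℂ) • u else 0 := by
    intro k
    induction k with
    | zero =>
      intro u hu n
      rw [powerKernel, Submodule.mem_bot] at hu
      simp [hu, circleIntegral]
    | succ k ih =>
      intro u hu n
      obtain ⟨u', hu', rfl⟩ := hu
      have hv := ih _ hu' (n + 1)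
      rw [if_neg (Nat.succ_ne_zero n)] at hv
      set v : X := (T.toFun - z • T.domain.subtype) u'
      have hcongr : Set.EqOn (fun w => (w - z) ^ (-(n : ℤ)) • (R w * J w) (u' : X))
          (fun w => (w - z) ^ (-((n + 1 : ℕ) : ℤ)) • (R w * J w) v -
            (w - z) ^ (-((n + 1 : ℕ) : ℤ)) • (u' : X)) (Metric.sphere z r) := by
        intro w hw
        have h1 := h.left_inverse (hsS hw) (hunit w hw) u'
        have h2 : T u' - w • (u' : X) = v - (w - z) • (u' : X) := by
          have : v = T u' - z • (u' : X) := rfl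
          rw [this]; module
        rw [h2, map_sub, map_sub, map_smul, map_smul] at h1
        have h3 : (R w * J w) v - (u' : X) = (w - z) • (R w * J w) (u' : X) := by
          rw [sub_eq_iff_eq_add, ← sub_eq_iff_eq_add']
          exact h1
        have hwz : w - z ≠ 0 := sub_ne_zero.mpr (hne w hw)
        simp only
        rw [← smul_sub, h3, smul_smul, ← zpow_add_one₀ hwz]
        congr 2
        push_cast; ring
      have hi1 : CircleIntegrable (fun w => (w - z) ^ (-((n + 1 : ℕ) : ℤ)) • (R w * J w) v) z r :=
        ((hpow _).smul (happ v)).circleIntegrable hr0.le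
      have hi2 : CircleIntegrable (fun w => (w - z) ^ (-((n + 1 : ℕ) : ℤ)) • (u' : X)) z r :=
        ((hpow _).smul continuousOn_const).circleIntegrable hr0.le
      change (∮ w in C(z, r), (w - z) ^ (-(n : ℤ)) • (R w * J w) (u' : X)) =
        if n = 0 then (-(2 * Real.pi * Complex.I) : ℂ) • (u' : X) else 0
      rw [circleIntegral.integral_congr hr0.le hcongr, circleIntegral.integral_sub hi1 hi2, hv,
        circleIntegral.integral_smul_const, zero_sub]
      split_ifs with hn
      · subst hn
        have := circleIntegral.integral_sub_center_inv z hr0.ne'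
        simp only [zero_add, Nat.cast_one, zpow_neg_one]
        rw [this, neg_smul]
      · rw [circleIntegral.integral_sub_zpow_of_ne (by push_cast; omega), zero_smul, neg_zero]
  refine iSup_toENat_rank_lt_top hP (c := -(2 * Real.pi * Complex.I))
    (neg_ne_zero.mpr Complex.two_pi_I_ne_zero) (powerKernel T z) fun k u hu => ?_
  have h1 := hstep k u hu 0
  rw [if_pos rfl] at h1
  rw [← h1]
  change ContinuousLinearMap.apply ℂ X u P = _
  rw [ContinuousLinearMap.map_circleIntegral _ hRJi]
  simp

/-- Inside S every eigenvalue is automatically discrete: isolation and finite multiplicity both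
follow from invertibility of 1 + K at one point. -/
theorem mem_discreteSpectrum_iff (h : IsFredholmFactorization T S R K) {z₁ : ℂ} (hz₁ : z₁ ∈ S)
    (hu : IsUnit (1 + K z₁)) {z : ℂ} (hz : z ∈ S) :
    z ∈ discreteSpectrum T ↔ ¬ IsUnit (1 + K z) := by
  refine ⟨fun hd => (h.isOperatorEigenvalue_iff hz).mp hd.1, fun hn =>
    ⟨(h.isOperatorEigenvalue_iff hz).mpr hn, ?_, h.algebraicMultiplicity_lt_top hz₁ hu hz⟩⟩
  filter_upwards [h.analytic_right.eventually_isUnit_one_add h.isPreconnected h.compact hz₁ hu hz,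
    nhdsWithin_le_nhds (h.isOpen.mem_nhds hz)] with w hw hwS
  exact fun hns => hns (h.isResolventPoint hwS hw)

end IsFredholmFactorization

end Factorization

/-! ### The free Hamiltonian on the Fourier side -/

section Free

open FourierTransform TemperedDistribution

variable {d : ℕ}

theorem memLp_bounded_mul {m : Space d → ℂ} (hm : Continuous m) {C : ℝ} (hC : ∀ x, ‖m x‖ ≤ C)
    (f : L2Space d) : MemLp (fun x => m x * f x) 2 volume :=
  (Lp.memLp f).of_le_mul (hm.aestronglyMeasurable.mul (Lp.aestronglyMeasurable f))
    (Eventually.of_forall fun x => by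
      rw [norm_mul]
      exact mul_le_mul_of_nonneg_right (hC x) (norm_nonneg _))

/-- Multiplication by a bounded continuous function on `L²`. -/
def boundedMul {m : Space d → ℂ} (hm : Continuous m) {C : ℝ} (hC : ∀ x, ‖m x‖ ≤ C) :
    L2Space d →L[ℂ] L2Space d :=
  LinearMap.mkContinuous
    { toFun := fun f => (memLp_bounded_mul hm hC f).toLp _
      map_add' := fun f g => by
        rw [← MemLp.toLp_add]
        apply MemLp.toLp_congr
        filter_upwards [Lp.coeFn_add f g] with x hx
        rw [hx]
        exact mul_add _ _ _
      map_smul' := fun c f => by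
        rw [RingHom.id_apply, ← MemLp.toLp_const_smul]
        apply MemLp.toLp_congr
        filter_upwards [Lp.coeFn_smul c f] with x hx
        simp only [hx, Pi.smul_apply, smul_eq_mul]
        ring } C fun f => by
    refine Lp.norm_le_mul_norm_of_ae_le_mul ?_
    filter_upwards [(memLp_bounded_mul hm hC f).coeFn_toLp] with x hx
    change ‖(memLp_bounded_mul hm hC f).toLp _ x‖ ≤ _
    rw [hx, norm_mul]
    exact mul_le_mul_of_nonneg_right (hC x) (norm_nonneg _)

theorem coeFn_boundedMul {m : Space d → ℂ} (hm : Continuous m) {C : ℝ} (hC : ∀ x, ‖m x‖ ≤ C)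
    (f : L2Space d) : boundedMul hm hC f =ᵐ[volume] fun x => m x * f x :=
  (memLp_bounded_mul hm hC f).coeFn_toLp

theorem norm_boundedMul_le {m : Space d → ℂ} (hm : Continuous m) {C : ℝ} (hC : ∀ x, ‖m x‖ ≤ C) :
    ‖boundedMul hm hC‖ ≤ C :=
  LinearMap.mkContinuous_norm_le _ ((norm_nonneg _).trans (hC 0)) _

theorem toTemperedDistribution_eq_smulLeftCLM {g : Space d → ℂ} (hg : g.HasTemperateGrowth)
    {a b : L2Space d} (h : b =ᵐ[volume] fun x => g x * a x) :
    Lp.toTemperedDistribution b = smulLeftCLM ℂ g (Lp.toTemperedDistribution a) := by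
  ext φ
  simp only [Lp.toTemperedDistribution_apply, smulLeftCLM_apply_apply]
  refine integral_congr_ae ?_
  filter_upwards [h] with x hx
  simp only [hx, SchwartzMap.smulLeftCLM_apply_apply hg, smul_eq_mul]
  ring

/-- The symbol `|2πξ|²` of `-Δ`. -/
def laplaceSymbol (x : Space d) : ℂ := (((2 * Real.pi) ^ 2 * ‖x‖ ^ 2 : ℝ) : ℂ)

theorem laplaceSymbol_temperate : (laplaceSymbol (d := d)).HasTemperateGrowth := by
  unfold laplaceSymbol
  fun_prop

theorem continuous_laplaceSymbol : Continuous (laplaceSymbol (d := d)) :=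
  laplaceSymbol_temperate.1.continuous

/-- The weight `(1 + |ξ|²)⁻¹`. -/
def sobolevWeight (x : Space d) : ℂ := (((1 + ‖x‖ ^ 2) ^ (-1 : ℝ) : ℝ) : ℂ)

theorem sobolevWeight_temperate : (sobolevWeight (d := d)).HasTemperateGrowth := by
  unfold sobolevWeight
  fun_prop

theorem sobolevWeight_eq (x : Space d) : sobolevWeight x = ((1 + ‖x‖ ^ 2)⁻¹ : ℝ) := by
  rw [sobolevWeight, Real.rpow_neg_one]

theorem sobolevWeight_ne_zero (x : Space d) : sobolevWeight x ≠ 0 := by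
  rw [sobolevWeight_eq]
  exact_mod_cast (by positivity : (1 + ‖x‖ ^ 2)⁻¹ ≠ (0 : ℝ))

theorem norm_sobolevWeight_le (x : Space d) : ‖sobolevWeight x‖ ≤ 1 := by
  rw [sobolevWeight_eq, Complex.norm_real, Real.norm_of_nonneg (by positivity)]
  exact inv_le_one_of_one_le₀ (by nlinarith [sq_nonneg ‖x‖])

theorem norm_sobolevWeight_mul_le (x : Space d) :
    ‖(sobolevWeight * laplaceSymbol : Space d → ℂ) x‖ ≤ (2 * Real.pi) ^ 2 := by
  rw [Pi.mul_apply, sobolevWeight_eq, laplaceSymbol, ← Complex.ofReal_mul, Complex.norm_real,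
    Real.norm_of_nonneg (by positivity), inv_mul_le_iff₀ (by positivity)]
  nlinarith [sq_nonneg ‖x‖, sq_nonneg (2 * Real.pi)]

/-- The symbol is unbounded, so its product with a is not known to be in L². Multiplying by the
nowhere vanishing weight makes both sides L² functions, where equality of distributions is equality
a.e.; the weight is then cancelled. -/
theorem toTemperedDistribution_eq_smulLeftCLM_iff {a b : L2Space d} :
    Lp.toTemperedDistribution b = smulLeftCLM ℂ laplaceSymbol (Lp.toTemperedDistribution a) ↔
      b =ᵐ[volume] fun x => laplaceSymbol x * a x := by
  refine ⟨fun h => ?_, toTemperedDistribution_eq_smulLeftCLM laplaceSymbol_temperate⟩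
  have hw := sobolevWeight_temperate (d := d)
  have hp := laplaceSymbol_temperate (d := d)
  have h1 := congrArg (smulLeftCLM ℂ sobolevWeight) h
  rw [smulLeftCLM_smulLeftCLM_apply hp hw, mul_comm] at h1
  have e1 := coeFn_boundedMul hw.1.continuous norm_sobolevWeight_le b
  have e2 := coeFn_boundedMul (hw.mul hp).1.continuous norm_sobolevWeight_mul_le a
  rw [← toTemperedDistribution_eq_smulLeftCLM hw e1,
    ← toTemperedDistribution_eq_smulLeftCLM (hw.mul hp) e2] at h1
  have h2 := toTemperedDistribution_injective h1
  rw [h2] at e1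
  filter_upwards [e1, e2] with x h3 h4
  rw [h3] at h4
  simp only [Pi.mul_apply, mul_assoc] at h4
  exact mul_left_cancel₀ (sobolevWeight_ne_zero x) h4

theorem neg_laplacian_eq_iff {u v : L2Space d} :
    Lp.toTemperedDistribution v = -Δ (Lp.toTemperedDistribution u) ↔
      (𝓕 v : L2Space d) =ᵐ[volume] fun x => laplaceSymbol x * (𝓕 u : L2Space d) x := by
  rw [← toTemperedDistribution_eq_smulLeftCLM_iff, ← Lp.fourier_toTemperedDistribution_eq,
    ← Lp.fourier_toTemperedDistribution_eq]
  have h : 𝓕 (-Δ (Lp.toTemperedDistribution u)) =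
      smulLeftCLM ℂ laplaceSymbol (𝓕 (Lp.toTemperedDistribution u)) := by
    have hs : (fun x : Space d => Complex.ofReal (‖x‖ ^ 2)).HasTemperateGrowth := by fun_prop
    have h1 : (laplaceSymbol (d := d)) =
        (((2 * Real.pi) ^ 2 : ℝ) : ℂ) • fun x : Space d => Complex.ofReal (‖x‖ ^ 2) := by
      ext x
      simp [laplaceSymbol]
    rw [laplacian_eq_fourierMultiplierCLM, neg_smul, neg_neg, h1, smulLeftCLM_smul hs,
      fourierMultiplierCLM_apply, ← Complex.coe_smul, ← fourierInv_smul, fourier_fourierInv_eq]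
    rfl
  rw [← h]
  constructor
  · intro h1; rw [h1]
  · intro h1
    have := congrArg (fun T => 𝓕⁻ T) h1
    simpa using this

/-- Elliptic regularity: if u and v = -Δu are in L², then (1 + |ξ|²)û = û + (2π)⁻²v̂ is in L², so u
is in H². -/
theorem freeHamiltonian_eq_iff_laplacian {u v : L2Space d} :
    (∃ h : u ∈ (freeHamiltonian d).domain, freeHamiltonian d ⟨u, h⟩ = v) ↔
      Lp.toTemperedDistribution v = -Δ (Lp.toTemperedDistribution u) := by
  constructor
  · rintro ⟨h, rfl⟩
    exact freeHamiltonian_spec ⟨u, h⟩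
  · intro h
    have hm : u ∈ (freeHamiltonian d).domain := by
      change MemSobolev 2 2 (Lp.toTemperedDistribution u)
      rw [memSobolev_iff_exists_smulLeftCLM_fourier]
      refine ⟨(𝓕 u : L2Space d) + (((2 * Real.pi) ^ 2 : ℝ)⁻¹ : ℂ) • (𝓕 v : L2Space d), ?_⟩
      rw [Lp.fourier_toTemperedDistribution_eq]
      refine (toTemperedDistribution_eq_smulLeftCLM (by fun_prop) ?_).symm
      filter_upwards [neg_laplacian_eq_iff.mp h, Lp.coeFn_add (𝓕 u : L2Space d)
        ((((2 * Real.pi) ^ 2 : ℝ)⁻¹ : ℂ) • (𝓕 v : L2Space d)),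
        Lp.coeFn_smul (((2 * Real.pi) ^ 2 : ℝ)⁻¹ : ℂ) (𝓕 v : L2Space d)] with x h1 h2 h3
      rw [h2, Pi.add_apply, h3, Pi.smul_apply, h1, laplaceSymbol]
      have hpi : (((2 * Real.pi) ^ 2 : ℝ) : ℂ) ≠ 0 := by
        exact_mod_cast (by positivity : ((2 * Real.pi) ^ 2 : ℝ) ≠ 0)
      have : (1 + ‖x‖ ^ 2) ^ ((2 : ℝ) / 2) = 1 + ‖x‖ ^ 2 := by norm_num
      rw [this]
      simp only [smul_eq_mul]
      rw [Complex.ofReal_mul, Complex.ofReal_add, Complex.ofReal_one]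
      field_simp
    refine ⟨hm, toTemperedDistribution_injective ?_⟩
    rw [h]
    exact freeHamiltonian_spec ⟨u, hm⟩

theorem freeHamiltonian_eq_iff {u v : L2Space d} :
    (∃ h : u ∈ (freeHamiltonian d).domain, freeHamiltonian d ⟨u, h⟩ = v) ↔
      (𝓕 v : L2Space d) =ᵐ[volume] fun x => laplaceSymbol x * (𝓕 u : L2Space d) x :=
  freeHamiltonian_eq_iff_laplacian.trans neg_laplacian_eq_iff

/-- On the Fourier side the resolvent is multiplication by (|2πξ|² - z)⁻¹. The constant C is left
free to serve both negative real z and non-real z. -/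
theorem exists_freeHamiltonian_resolvent {z : ℂ} {C : ℝ}
    (hC : ∀ t : ℝ, 0 ≤ t → (t : ℂ) - z ≠ 0 ∧ ‖((t : ℂ) - z)⁻¹‖ ≤ C) :
    ∃ R : L2Space d →L[ℂ] L2Space d, ‖R‖ ≤ C ∧
      (∀ f, ∃ h : R f ∈ (freeHamiltonian d).domain, freeHamiltonian d ⟨R f, h⟩ - z • R f = f) ∧
      ∀ u : (freeHamiltonian d).domain, R (freeHamiltonian d u - z • (u : L2Space d)) = u := by
  have hne : ∀ x : Space d, laplaceSymbol x - z ≠ 0 := fun x => (hC _ (by positivity)).1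
  have hcont : Continuous fun x : Space d => (laplaceSymbol x - z)⁻¹ :=
    (continuous_laplaceSymbol.sub continuous_const).inv₀ hne
  have hbd : ∀ x : Space d, ‖(laplaceSymbol x - z)⁻¹‖ ≤ C := fun x => (hC _ (by positivity)).2
  let M := boundedMul hcont hbd
  let Φ : L2Space d ≃ₗᵢ[ℂ] L2Space d := Lp.fourierTransformₗᵢ (Space d) ℂ
  have hΦ : ∀ f, Φ f = 𝓕 f := fun f => rfl
  let R : L2Space d →L[ℂ] L2Space d :=
    (Φ.symm : L2Space d →L[ℂ] L2Space d) ∘L M ∘L (Φ : L2Space d →L[ℂ] L2Space d)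
  have hΦR : ∀ f, 𝓕 (R f) = M (𝓕 f) := fun f => by
    rw [← hΦ, ← hΦ]
    exact Φ.apply_symm_apply _
  refine ⟨R, ?_, fun f => ?_, fun u => ?_⟩
  · refine ContinuousLinearMap.opNorm_le_bound _ ((norm_nonneg _).trans (hbd 0)) fun f => ?_
    change ‖Φ.symm (M (Φ f))‖ ≤ _
    rw [Φ.symm.norm_map, ← Φ.norm_map f]
    exact M.le_of_opNorm_le (norm_boundedMul_le hcont hbd) _
  · have h : (𝓕 (f + z • R f) : L2Space d) =ᵐ[volume]
        fun x => laplaceSymbol x * (𝓕 (R f) : L2Space d) x := by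
      rw [FourierAdd.fourier_add, fourier_smul, hΦR]
      filter_upwards [Lp.coeFn_add (𝓕 f : L2Space d) (z • M (𝓕 f)),
        Lp.coeFn_smul z (M (𝓕 f)), coeFn_boundedMul hcont hbd (𝓕 f)] with x h1 h2 h3
      rw [h1, Pi.add_apply, h2, Pi.smul_apply, h3, smul_eq_mul]
      have := hne x
      field_simp
      ring
    obtain ⟨hm, he⟩ := freeHamiltonian_eq_iff.mpr h
    exact ⟨hm, by rw [he, add_sub_cancel_right]⟩
  · have h := freeHamiltonian_eq_iff.mp ⟨u.2, rfl⟩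
    apply Φ.injective
    rw [hΦ, hΦR, hΦ, sub_eq_add_neg, ← neg_smul, FourierAdd.fourier_add, fourier_smul]
    apply Lp.ext
    refine (coeFn_boundedMul hcont hbd _).trans ?_
    filter_upwards [h, Lp.coeFn_add (𝓕 (freeHamiltonian d u) : L2Space d)
      (-z • (𝓕 (u : L2Space d))), Lp.coeFn_smul (-z) (𝓕 (u : L2Space d))] with x h1 h2 h3
    rw [h2, Pi.add_apply, h3, Pi.smul_apply, smul_eq_mul]
    rw [h1]
    have := hne x
    field_simp
    ring

theorem toLp_mem_domain (φ : SchwartzMap (Space d) ℂ) :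
    (φ.toLp 2 : L2Space d) ∈ (freeHamiltonian d).domain := by
  have h : MemSobolev 2 2 (Lp.toTemperedDistribution (φ.toLp 2 : L2Space d)) := by
    rw [Lp.toTemperedDistribution_toLp_eq]
    exact SchwartzMap.memSobolev φ
  exact h

theorem freeHamiltonian_dense : Dense ((freeHamiltonian d).domain : Set (L2Space d)) := by
  have h : DenseRange (SchwartzMap.toLpCLM ℝ ℂ 2 (volume : Measure (Space d))) :=
    SchwartzMap.denseRange_toLpCLM ENNReal.ofNat_ne_top
  refine Dense.mono ?_ h
  intro x hx
  obtain ⟨φ, rfl⟩ := hx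
  exact toLp_mem_domain φ

end Free

/-! ### Dilations on `L²` -/

section Dilation

variable {d : ℕ}

/-- The Jacobian factor of the dilation by `e^t`. -/
def dilationFactor (d : ℕ) (t : ℝ) : ℝ≥0∞ :=
  ENNReal.ofReal |(Real.exp t ^ Module.finrank ℝ (Space d))⁻¹|

theorem map_dilation (t : ℝ) :
    Measure.map (fun x : Space d => Real.exp t • x) volume = dilationFactor d t • volume :=
  Measure.map_addHaar_smul volume (Real.exp_ne_zero t)

theorem measurableEmbedding_dilation (t : ℝ) :
    MeasurableEmbedding (fun x : Space d => Real.exp t • x) :=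
  (Homeomorph.smulOfNeZero (Real.exp t) (Real.exp_ne_zero t)).measurableEmbedding

theorem quasiMeasurePreserving_dilation (t : ℝ) :
    Measure.QuasiMeasurePreserving (fun x : Space d => Real.exp t • x) volume volume := by
  refine ⟨(measurableEmbedding_dilation t).measurable, ?_⟩
  rw [map_dilation]
  exact Measure.smul_absolutelyContinuous

theorem memLp_comp_dilation (t : ℝ) (u : L2Space d) :
    MemLp (fun x => u (Real.exp t • x)) 2 volume := by
  refine ((measurableEmbedding_dilation t).memLp_map_measure_iff (g := u)).mp ?_
  rw [map_dilation]
  exact (Lp.memLp u).smul_measure ENNReal.ofReal_ne_top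

theorem eLpNorm_comp_dilation (t : ℝ) (u : L2Space d) :
    eLpNorm (fun x => u (Real.exp t • x)) 2 volume =
      (dilationFactor d t) ^ (1 / (2 : ℝ≥0∞)).toReal * eLpNorm u 2 volume := by
  have := (measurableEmbedding_dilation (d := d) t).eLpNorm_map_measure (g := u) (p := 2)
    (μ := volume)
  rw [map_dilation, eLpNorm_smul_measure_of_ne_top ENNReal.ofNat_ne_top] at this
  exact this.symm

/-- The dilation `u ↦ u(e^t ·)` on `L²`. -/
def dilation (d : ℕ) (t : ℝ) : L2Space d →L[ℂ] L2Space d :=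
  LinearMap.mkContinuous
    { toFun := fun u => (memLp_comp_dilation t u).toLp _
      map_add' := fun u v => by
        rw [← MemLp.toLp_add]
        apply MemLp.toLp_congr
        exact (quasiMeasurePreserving_dilation t).ae_eq_comp (Lp.coeFn_add u v)
      map_smul' := fun c u => by
        rw [RingHom.id_apply, ← MemLp.toLp_const_smul]
        apply MemLp.toLp_congr
        exact (quasiMeasurePreserving_dilation t).ae_eq_comp (Lp.coeFn_smul c u) }
    ((dilationFactor d t) ^ (1 / (2 : ℝ≥0∞)).toReal).toReal fun u => by
      change ‖(memLp_comp_dilation t u).toLp _‖ ≤ _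
      rw [Lp.norm_toLp, eLpNorm_comp_dilation, ENNReal.toReal_mul, Lp.norm_def]

theorem coeFn_dilation (t : ℝ) (u : L2Space d) :
    dilation d t u =ᵐ[volume] fun x => u (Real.exp t • x) :=
  (memLp_comp_dilation t u).coeFn_toLp

/-- The dilation carries no factor e^{td/2} and is not normalized to be unitary; a bounded inverse
is all that the later conjugations need. -/
theorem dilation_dilation_neg (t : ℝ) (u : L2Space d) : dilation d t (dilation d (-t) u) = u := by
  apply Lp.ext
  refine (coeFn_dilation t _).trans ?_
  have h := (quasiMeasurePreserving_dilation t).ae_eq_comp (coeFn_dilation (-t) u)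
  filter_upwards [h] with x hx
  simp only [Function.comp_apply] at hx
  rw [hx, smul_smul, ← Real.exp_add, neg_add_cancel, Real.exp_zero, one_smul]

theorem dilation_mul_neg (t : ℝ) : dilation d t * dilation d (-t) = 1 :=
  ContinuousLinearMap.ext fun u => dilation_dilation_neg t u

theorem dilation_neg_mul (t : ℝ) : dilation d (-t) * dilation d t = 1 := by
  simpa using dilation_mul_neg (d := d) (-t)

/-- Dilation by `e^{-t}` as a linear equivalence of `ℝᵈ`. -/
def scaleEquiv (d : ℕ) (t : ℝ) : Space d ≃L[ℝ] Space d :=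
  ContinuousLinearEquiv.smulLeft (Units.mk0 (Real.exp (-t)) (Real.exp_ne_zero _))

theorem scaleEquiv_apply (t : ℝ) (x : Space d) : scaleEquiv d t x = Real.exp (-t) • x := rfl

open scoped LineDeriv in
theorem laplacian_comp_scaleEquiv (t : ℝ) (φ : SchwartzMap (Space d) ℂ) (x : Space d) :
    Δ (SchwartzMap.compCLMOfContinuousLinearEquiv ℂ (scaleEquiv d t) φ) x =
      Real.exp (-t) ^ 2 * (Δ φ) (scaleEquiv d t x) := by
  rw [SchwartzMap.laplacian_eq_sum (stdOrthonormalBasis ℝ (Space d)),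
    SchwartzMap.laplacian_eq_sum (stdOrthonormalBasis ℝ (Space d)), sum_apply,
    sum_apply, Finset.mul_sum]
  refine Finset.sum_congr rfl fun i _ => ?_
  rw [SchwartzMap.lineDerivOp_compCLMOfContinuousLinearEquiv,
    SchwartzMap.lineDerivOp_compCLMOfContinuousLinearEquiv, scaleEquiv_apply]
  simp only [SchwartzMap.compCLMOfContinuousLinearEquiv_apply, Function.comp_apply,
    SchwartzMap.lineDerivOp_apply_eq_fderiv, LineDeriv.lineDerivOp_left_smul,
    LineDeriv.lineDerivOp_smul, smul_apply]
  simp only [Complex.real_smul]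
  push_cast
  ring

theorem toTemperedDistribution_dilation_apply (t : ℝ) (u : L2Space d)
    (φ : SchwartzMap (Space d) ℂ) :
    Lp.toTemperedDistribution (dilation d t u) φ =
      |(Real.exp t ^ Module.finrank ℝ (Space d))⁻¹| •
        ∫ x, φ (scaleEquiv d t x) * u x := by
  rw [← Measure.integral_comp_smul, Lp.toTemperedDistribution_apply]
  refine integral_congr_ae ?_
  filter_upwards [coeFn_dilation t u] with x hx
  rw [hx, scaleEquiv_apply, smul_smul, ← Real.exp_add, neg_add_cancel, Real.exp_zero, one_smul,
    smul_eq_mul]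

/-- Tested against φ, the dilation moves to φ as the inverse scaling with the same Jacobian on both
sides; the chain rule gives e^{-2t}, which the factor e^{2t} compensates. -/
theorem freeHamiltonian_dilation (t : ℝ) (u : (freeHamiltonian d).domain) :
    ∃ h : dilation d t u ∈ (freeHamiltonian d).domain,
      freeHamiltonian d ⟨dilation d t u, h⟩ =
        Complex.exp (2 * t) • dilation d t (freeHamiltonian d u) := by
  rw [freeHamiltonian_eq_iff_laplacian]
  ext φ
  have hspec := freeHamiltonian_spec u
  have h1 := congrArg (fun T : TemperedDistribution (Space d) ℂ =>
    T (SchwartzMap.compCLMOfContinuousLinearEquiv ℂ (scaleEquiv d t) φ)) hspec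
  have h2 : ∀ T : TemperedDistribution (Space d) ℂ, ∀ ψ, (-Δ T) ψ = -(T (Δ ψ)) := fun T ψ => by
    rw [← TemperedDistribution.laplacian_apply_apply]; rfl
  simp only [h2] at h1
  have h3 : ∀ (c : ℂ) (w : L2Space d), Lp.toTemperedDistribution (c • w) φ =
      c • Lp.toTemperedDistribution w φ := fun c w => by
    rw [← Lp.toTemperedDistributionCLM_apply, map_smul]; rfl
  rw [h2, toTemperedDistribution_dilation_apply, h3, toTemperedDistribution_dilation_apply]
  simp only [Lp.toTemperedDistribution_apply, laplacian_comp_scaleEquiv, smul_eq_mul] at h1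
  simp only [SchwartzMap.compCLMOfContinuousLinearEquiv_apply, Function.comp_apply] at h1
  rw [h1, smul_comm, ← smul_neg]
  congr 1
  simp only [mul_assoc]
  rw [integral_const_mul, smul_eq_mul, mul_neg, ← mul_assoc]
  have : Complex.exp (2 * t) * (Real.exp (-t) : ℂ) ^ 2 = 1 := by
    rw [Complex.ofReal_exp, ← Complex.exp_nat_mul, ← Complex.exp_add]
    simp
  rw [this, one_mul]

theorem multiplicationOperator_dilation {W W' : Space d → ℂ} {s : ℝ}
    (hW : W' =ᵐ[volume] fun x => W (Real.exp s • x)) (u : (multiplicationOperator W).domain) :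
    ∃ h : dilation d s u ∈ (multiplicationOperator W').domain,
      multiplicationOperator W' ⟨dilation d s u, h⟩ =
        dilation d s (multiplicationOperator W u) := by
  have hv : (multiplicationOperator W u : L2Space d) =ᵐ[volume] fun x => W x * (u : L2Space d) x :=
    MemLp.coeFn_toLp u.2
  have h1 : (fun x => W' x * (dilation d s u) x) =ᵐ[volume]
      dilation d s (multiplicationOperator W u) := by
    filter_upwards [hW, coeFn_dilation s (u : L2Space d),
      coeFn_dilation s (multiplicationOperator W u),
      (quasiMeasurePreserving_dilation s).ae_eq_comp hv] with x a1 a2 a3 a4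
    simp only [Function.comp_apply] at a4
    rw [a1, a2, a3, a4]
  have hm : MemLp (fun x => W' x * (dilation d s u) x) 2 volume :=
    (Lp.memLp (dilation d s (multiplicationOperator W u))).ae_eq h1.symm
  refine ⟨hm, Lp.ext ?_⟩
  exact hm.coeFn_toLp.trans h1

end Dilation

/-! ### The continued potential and the continued resolvent product agree -/

theorem frequently_punctured_of_real {P : ℂ → Prop} (h : ∀ t : ℝ, P t) :
    ∃ᶠ z in 𝓝[≠] (0 : ℂ), P z := by
  have ht : Tendsto (fun t : ℝ => (t : ℂ)) (𝓝[≠] 0) (𝓝[≠] 0) := by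
    refine tendsto_nhdsWithin_iff.mpr ⟨?_, ?_⟩
    · have := Complex.continuous_ofReal.tendsto (0 : ℝ)
      rw [Complex.ofReal_zero] at this
      exact this.mono_left nhdsWithin_le_nhds
    · filter_upwards [self_mem_nhdsWithin] with t ht
      simpa using ht
  exact ht.frequently (Eventually.of_forall h).frequently

theorem AnalyticOnNhd.eq_of_eq_real {E : Type*} [NormedAddCommGroup E] [NormedSpace ℂ E]
    {f g : ℂ → E} {S : Set ℂ} (hf : AnalyticOnNhd ℂ f S) (hg : AnalyticOnNhd ℂ g S)
    (hS : IsPreconnected S) (h0 : (0 : ℂ) ∈ S) (h : ∀ t : ℝ, f t = g t) {z : ℂ} (hz : z ∈ S) :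
    f z = g z :=
  hf.eqOn_of_preconnected_of_frequently_eq hg hS h0 (frequently_punctured_of_real h) hz

theorem dilationStrip_convex (α : ℝ) : Convex ℝ (dilationStrip α) := by
  have h : dilationStrip α = Complex.imLm ⁻¹' (Metric.ball 0 α) := by
    ext z
    simp [dilationStrip]
  rw [h]
  exact (convex_ball _ _).linear_preimage _

theorem ofReal_mem_dilationStrip {α : ℝ} (hα : 0 < α) (t : ℝ) : (t : ℂ) ∈ dilationStrip α := by
  simpa [dilationStrip] using hα

section Continuation

variable {d : ℕ} {γ α : ℝ} [Fact (1 ≤ γ)] {V : Space d → ℂ}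
  {F : ℂ → Lp ℂ (potentialExponent d γ) (volume : Measure (Space d))}
  {G : ℂ → (L2Space d →L[ℂ] L2Space d)}

/-- A bounded region on which `u` is bounded. -/
def truncationSet (u : L2Space d) (N : ℕ) : Set (Space d) :=
  {x | ‖u x‖ ≤ N} ∩ Metric.closedBall 0 N

theorem measurableSet_truncationSet (u : L2Space d) (N : ℕ) :
    MeasurableSet (truncationSet u N) :=
  (measurableSet_le (Lp.stronglyMeasurable u).norm.measurable measurable_const).inter
    measurableSet_closedBall

theorem measure_truncationSet_lt_top (u : L2Space d) (N : ℕ) :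
    volume (truncationSet u N) < ∞ :=
  (measure_mono Set.inter_subset_right).trans_lt measure_closedBall_lt_top

theorem iUnion_truncationSet (u : L2Space d) : ⋃ N, truncationSet u N = Set.univ := by
  refine Set.eq_univ_of_forall fun x => ?_
  obtain ⟨N, hN⟩ := exists_nat_ge (max ‖u x‖ ‖x‖)
  exact Set.mem_iUnion.mpr ⟨N, (le_max_left _ _).trans hN, by
    simpa using (le_max_right _ _).trans hN⟩

theorem memLp_indicator_of_subset_truncationSet (u : L2Space d) {N : ℕ} {A : Set (Space d)}
    (hA : MeasurableSet A) (hAN : A ⊆ truncationSet u N) (q : ℝ≥0∞) :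
    MemLp (A.indicator u) q volume := by
  rw [memLp_indicator_iff_restrict hA]
  have : IsFiniteMeasure (volume.restrict A) :=
    ⟨by
      rw [Measure.restrict_apply_univ]
      exact (measure_mono hAN).trans_lt (measure_truncationSet_lt_top u N)⟩
  refine MemLp.of_bound (Lp.aestronglyMeasurable u).restrict N ?_
  filter_upwards [ae_restrict_mem hA] with x hx
  exact (hAN hx).1

theorem exists_clm_setIntegral_mul {p : ℝ≥0∞} [hp : Fact (1 ≤ p)] (u : L2Space d) {N : ℕ}
    {A : Set (Space d)} (hA : MeasurableSet A) (hAN : A ⊆ truncationSet u N) :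
    ∃ ℓ : Lp ℂ p (volume : Measure (Space d)) →L[ℂ] ℂ, ∀ f, ℓ f = ∫ x in A, f x * u x := by
  have := ENNReal.HolderConjugate.inv_one_sub_inv' hp.out
  have : Fact (1 ≤ (1 - p⁻¹)⁻¹) := by simp [fact_iff]
  have hm := memLp_indicator_of_subset_truncationSet u hA hAN (1 - p⁻¹)⁻¹
  refine ⟨((ContinuousLinearMap.mul ℂ ℂ).lpPairing volume p (1 - p⁻¹)⁻¹).flip (hm.toLp _),
    fun f => ?_⟩
  rw [ContinuousLinearMap.flip_apply, ContinuousLinearMap.lpPairing_eq_integral,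
    ← integral_indicator hA]
  refine integral_congr_ae ?_
  filter_upwards [hm.coeFn_toLp] with x hx
  rw [hx]
  by_cases h : x ∈ A <;> simp [h]

theorem exists_clm_setIntegral (u : L2Space d) {N : ℕ}
    {A : Set (Space d)} (hA : MeasurableSet A) (hAN : A ⊆ truncationSet u N) :
    ∃ ℓ : L2Space d →L[ℂ] ℂ, ∀ f, ℓ f = ∫ x in A, f x := by
  have hfin : volume A ≠ ∞ := ((measure_mono hAN).trans_lt (measure_truncationSet_lt_top u N)).ne
  refine ⟨innerSL ℂ (indicatorConstLp 2 hA hfin (1 : ℂ)), fun f => ?_⟩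
  exact L2.inner_indicatorConstLp_one hA hfin f

/-- `F` and `G` take values in different spaces, so they are compared through scalar functions. On A
the function u is bounded and A has finite measure, so both integrals are bounded functionals of `F
θ` and `G θ`; they are analytic in θ and agree on the real line. -/
theorem setIntegral_continuation_eq (hα : 0 < α) (hF : IsDilationContinuation γ α V F)
    (hG : AnalyticOnNhd ℂ G (dilationStrip α))
    (hGV : ∀ t : ℝ, IsResolventProduct (realDilation V t) (G (t : ℂ)))
    (u : (freeHamiltonian d).domain) {N : ℕ} {A : Set (Space d)} (hA : MeasurableSet A)
    (hAN : A ⊆ truncationSet (u : L2Space d) N) {θ : ℂ} (hθ : θ ∈ dilationStrip α) :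
    ∫ x in A, F θ x * (u : L2Space d) x = ∫ x in A, G θ (freeHamiltonian d u + u) x := by
  obtain ⟨ℓ₁, h₁⟩ := exists_clm_setIntegral_mul (p := potentialExponent d γ) (u : L2Space d) hA hAN
  obtain ⟨ℓ₂, h₂⟩ := exists_clm_setIntegral (u : L2Space d) hA hAN
  rw [← h₁, ← h₂]
  have a₁ : AnalyticOnNhd ℂ (fun z => ℓ₁ (F z)) (dilationStrip α) := fun z hz =>
    (ℓ₁.analyticAt _).comp (hF.analytic z hz)
  have a₂ : AnalyticOnNhd ℂ (fun z => ℓ₂ (G z (freeHamiltonian d u + u))) (dilationStrip α) :=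
    fun z hz => (ℓ₂.analyticAt _).comp
      (((ContinuousLinearMap.apply ℂ (L2Space d) (freeHamiltonian d u + u)).analyticAt _).comp
        (hG z hz))
  refine a₁.eq_of_eq_real a₂ (dilationStrip_convex α).isPreconnected
    (by simpa using ofReal_mem_dilationStrip hα 0) (fun t => ?_) hθ
  rw [h₁, h₂]
  obtain ⟨hm, he⟩ := hGV t u
  refine setIntegral_congr_ae hA ?_
  have hv : (multiplicationOperator (realDilation V t) ⟨u, hm⟩ : L2Space d) =ᵐ[volume]
      fun x => realDilation V t x * (u : L2Space d) x := MemLp.coeFn_toLp hm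
  rw [he]
  filter_upwards [hv, hF.eq_real t] with x h3 h4 _
  rw [h3, h4]

/-- Equal integrals over all measurable subsets of a truncation set force equality a.e. on it, and
the truncation sets exhaust the space. -/
theorem continuation_mul_ae_eq (hα : 0 < α) (hF : IsDilationContinuation γ α V F)
    (hG : AnalyticOnNhd ℂ G (dilationStrip α))
    (hGV : ∀ t : ℝ, IsResolventProduct (realDilation V t) (G (t : ℂ)))
    (u : (freeHamiltonian d).domain) {θ : ℂ} (hθ : θ ∈ dilationStrip α) :
    (fun x => F θ x * (u : L2Space d) x) =ᵐ[volume] G θ (freeHamiltonian d u + u) := by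
  have hres : ∀ N, (fun x => F θ x * (u : L2Space d) x)
      =ᵐ[volume.restrict (truncationSet (u : L2Space d) N)]
        G θ (freeHamiltonian d u + u) := by
    intro N
    have hS := measurableSet_truncationSet (u : L2Space d) N
    have : IsFiniteMeasure (volume.restrict (truncationSet (u : L2Space d) N)) :=
      ⟨by
        rw [Measure.restrict_apply_univ]
        exact measure_truncationSet_lt_top (u : L2Space d) N⟩
    refine Integrable.ae_eq_of_forall_setIntegral_eq _ _ ?_ ?_ fun A hA _ => ?_
    · have h1 : Integrable (F θ) (volume.restrict (truncationSet (u : L2Space d) N)) :=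
        ((Lp.memLp (F θ)).restrict _).integrable
          (fact_one_le_potentialExponent d γ).out
      refine h1.mul_bdd (c := N) (Lp.aestronglyMeasurable _).restrict ?_
      filter_upwards [ae_restrict_mem hS] with x hx
      exact hx.1
    · exact ((Lp.memLp _).restrict _).integrable one_le_two
    · rw [Measure.restrict_restrict hA]
      exact setIntegral_continuation_eq hα hF hG hGV u (hA.inter hS) Set.inter_subset_right hθ
  have := (ae_restrict_iUnion_iff (μ := volume) (truncationSet (u : L2Space d))
    (fun x => F θ x * (u : L2Space d) x = G θ (freeHamiltonian d u + u) x)).mpr hres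
  rwa [iUnion_truncationSet, Measure.restrict_univ] at this

theorem isResolventProduct_continuation (hα : 0 < α) (hF : IsDilationContinuation γ α V F)
    (hG : AnalyticOnNhd ℂ G (dilationStrip α))
    (hGV : ∀ t : ℝ, IsResolventProduct (realDilation V t) (G (t : ℂ)))
    {θ : ℂ} (hθ : θ ∈ dilationStrip α) : IsResolventProduct (F θ) (G θ) := by
  intro u
  have h := continuation_mul_ae_eq hα hF hG hGV u hθ
  have hm : MemLp (fun x => F θ x * (u : L2Space d) x) 2 volume := (Lp.memLp _).ae_eq h.symm
  exact ⟨hm, Lp.ext (h.symm.trans hm.coeFn_toLp.symm)⟩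

end Continuation

/-! ### The free resolvent -/

section FreeResolvent

variable {d : ℕ}

/-- The resolvent `(H₀ - z)⁻¹` of the free Hamiltonian (zero if `z` is in the spectrum). -/
def freeResolvent (d : ℕ) (z : ℂ) : L2Space d →L[ℂ] L2Space d :=
  open Classical in if h : IsResolventPoint (freeHamiltonian d) z then h.choose else 0

theorem freeResolvent_spec {z : ℂ} (h : IsResolventPoint (freeHamiltonian d) z) :
    (∀ f, ∃ hf : freeResolvent d z f ∈ (freeHamiltonian d).domain,
      freeHamiltonian d ⟨freeResolvent d z f, hf⟩ - z • freeResolvent d z f = f) ∧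
    ∀ u : (freeHamiltonian d).domain,
      freeResolvent d z (freeHamiltonian d u - z • (u : L2Space d)) = u := by
  rw [freeResolvent, dif_pos h]
  exact h.choose_spec

theorem norm_inv_sub_le_of_im {z : ℂ} (hz : z.im ≠ 0) (t : ℝ) :
    (t : ℂ) - z ≠ 0 ∧ ‖((t : ℂ) - z)⁻¹‖ ≤ |z.im|⁻¹ := by
  have h1 : |z.im| ≤ ‖(t : ℂ) - z‖ := by
    have := Complex.abs_im_le_norm ((t : ℂ) - z)
    simpa using this
  have h2 : 0 < |z.im| := abs_pos.mpr hz
  refine ⟨norm_pos_iff.mp (h2.trans_le h1), ?_⟩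
  rw [norm_inv]
  exact inv_anti₀ h2 h1

/-- The condition on -z says exactly that z is off [0,∞). -/
theorem isResolventPoint_freeHamiltonian {z : ℂ} (hz : -z ∈ Complex.slitPlane) :
    IsResolventPoint (freeHamiltonian d) z := by
  rw [Complex.mem_slitPlane_iff] at hz
  by_cases him : z.im = 0
  · have hre : z.re < 0 := by
      rcases hz with h | h
      · simpa using h
      · simp [him] at h
    obtain ⟨R, -, h⟩ := exists_freeHamiltonian_resolvent (d := d) (z := z) (C := (-z.re)⁻¹)
      fun t ht => by
        have h1 : -z.re ≤ ‖(t : ℂ) - z‖ := by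
          have := Complex.re_le_norm ((t : ℂ) - z)
          simp only [Complex.sub_re, Complex.ofReal_re] at this
          linarith
        have h2 : 0 < -z.re := neg_pos.mpr hre
        refine ⟨norm_pos_iff.mp (h2.trans_le h1), ?_⟩
        rw [norm_inv]
        exact inv_anti₀ h2 h1
    exact ⟨R, h⟩
  · obtain ⟨R, -, h⟩ := exists_freeHamiltonian_resolvent (d := d) (z := z)
      fun t _ => norm_inv_sub_le_of_im him t
    exact ⟨R, h⟩

theorem norm_freeResolvent_le {z : ℂ} (hz : z.im ≠ 0) : ‖freeResolvent d z‖ ≤ |z.im|⁻¹ := by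
  obtain ⟨R, hR, h⟩ := exists_freeHamiltonian_resolvent (d := d) (z := z)
    fun t _ => norm_inv_sub_le_of_im hz t
  have h1 := (freeResolvent_spec ⟨R, h⟩).2
  have : freeResolvent d z = R := by
    ext1 f
    obtain ⟨hm, he⟩ := h.1 f
    have := h1 ⟨R f, hm⟩
    rwa [he] at this
  rwa [this]

theorem neg_one_resolvent : -(-1 : ℂ) ∈ Complex.slitPlane := by simp

/-- The operator `(H₀ + 1)(H₀ - w)⁻¹`. -/
def shiftedResolvent (d : ℕ) (w : ℂ) : L2Space d →L[ℂ] L2Space d :=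
  1 + (w + 1) • freeResolvent d w

theorem shiftedResolvent_apply (w : ℂ) (f : L2Space d) :
    shiftedResolvent d w f = f + (w + 1) • freeResolvent d w f := rfl

theorem freeResolvent_eq_add {z w : ℂ} (hz : IsResolventPoint (freeHamiltonian d) z)
    (hw : IsResolventPoint (freeHamiltonian d) w) :
    freeResolvent d w = freeResolvent d z + (w - z) • (freeResolvent d z * freeResolvent d w) := by
  ext1 f
  obtain ⟨hm, he⟩ := (freeResolvent_spec hw).1 f
  have h := (freeResolvent_spec hz).2 ⟨_, hm⟩
  have h1 : freeHamiltonian d ⟨_, hm⟩ - z • freeResolvent d w f =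
      f + (w - z) • freeResolvent d w f := by
    linear_combination (norm := module) he
  rw [h1, map_add, map_smul] at h
  exact h.symm

/-- Formally (H₀ - w)(H₀+1)⁻¹ = 1 - (w+1)(H₀+1)⁻¹. Thus `shiftedResolvent` inverts an operator
affine in w, and its analyticity follows from that of inversion. -/
theorem shiftedResolvent_isUnit {w : ℂ} (hw : -w ∈ Complex.slitPlane) :
    IsUnit (1 - (w + 1) • freeResolvent d (-1)) ∧
      Ring.inverse (1 - (w + 1) • freeResolvent d (-1)) = shiftedResolvent d w := by
  have hB := isResolventPoint_freeHamiltonian (d := d) neg_one_resolvent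
  have hR := isResolventPoint_freeHamiltonian (d := d) hw
  have e1 := freeResolvent_eq_add hB hR
  have e2 := freeResolvent_eq_add hR hB
  rw [sub_neg_eq_add] at e1
  have e2' : freeResolvent d w =
      freeResolvent d (-1) + (w + 1) • (freeResolvent d w * freeResolvent d (-1)) := by
    linear_combination (norm := module) -e2
  let u : (L2Space d →L[ℂ] L2Space d)ˣ :=
    ⟨1 - (w + 1) • freeResolvent d (-1), shiftedResolvent d w, by
      rw [shiftedResolvent, mul_add, mul_one, sub_mul, one_mul, smul_mul_assoc, mul_smul_comm]
      linear_combination (norm := module) (w + 1) • e1, by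
      rw [shiftedResolvent, mul_sub, mul_one, add_mul, one_mul, smul_mul_assoc, mul_smul_comm]
      linear_combination (norm := module) (w + 1) • e2'⟩
  exact ⟨⟨u, rfl⟩, Ring.inverse_unit u⟩

theorem shiftedResolvent_analyticAt {w : ℂ} (hw : -w ∈ Complex.slitPlane) :
    AnalyticAt ℂ (shiftedResolvent d) w := by
  have h1 : AnalyticAt ℂ (fun z : ℂ => 1 - (z + 1) • freeResolvent d (-1)) w :=
    analyticAt_const.sub ((analyticAt_id.add analyticAt_const).smul analyticAt_const)
  refine (h1.ringInverse (shiftedResolvent_isUnit hw).1).congr ?_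
  have : ∀ᶠ z in 𝓝 w, -z ∈ Complex.slitPlane :=
    continuous_neg.continuousAt.eventually (Complex.isOpen_slitPlane.mem_nhds hw)
  filter_upwards [this] with z hz
  exact (shiftedResolvent_isUnit hz).2

theorem freeResolvent_eq_mul {w : ℂ} (hw : -w ∈ Complex.slitPlane) :
    freeResolvent d w = freeResolvent d (-1) * shiftedResolvent d w := by
  have e1 := freeResolvent_eq_add (isResolventPoint_freeHamiltonian (d := d) neg_one_resolvent)
    (isResolventPoint_freeHamiltonian (d := d) hw)
  rw [sub_neg_eq_add] at e1
  rw [shiftedResolvent, mul_add, mul_one, mul_smul_comm]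
  exact e1

theorem freeResolvent_analyticAt {w : ℂ} (hw : -w ∈ Complex.slitPlane) :
    AnalyticAt ℂ (freeResolvent d) w := by
  refine AnalyticAt.congr (analyticAt_const.mul (shiftedResolvent_analyticAt hw)) ?_
    (f := fun z => freeResolvent d (-1) * shiftedResolvent d z)
  have : ∀ᶠ z in 𝓝 w, -z ∈ Complex.slitPlane :=
    continuous_neg.continuousAt.eventually (Complex.isOpen_slitPlane.mem_nhds hw)
  filter_upwards [this] with z hz
  exact (freeResolvent_eq_mul hz).symm

theorem freeHamiltonian_add_freeResolvent {w : ℂ} (hw : -w ∈ Complex.slitPlane) (f : L2Space d) :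
    ∃ h : freeResolvent d w f ∈ (freeHamiltonian d).domain,
      freeHamiltonian d ⟨_, h⟩ = f + w • freeResolvent d w f ∧
      freeHamiltonian d ⟨_, h⟩ + freeResolvent d w f = shiftedResolvent d w f := by
  obtain ⟨hm, he⟩ := (freeResolvent_spec (isResolventPoint_freeHamiltonian (d := d) hw)).1 f
  refine ⟨hm, sub_eq_iff_eq_add.mp he, ?_⟩
  rw [sub_eq_iff_eq_add.mp he, shiftedResolvent_apply]
  module

theorem dilation_freeResolvent {w : ℂ} (hw : -w ∈ Complex.slitPlane) (s : ℝ)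
    (hw' : -(Complex.exp (2 * s) * w) ∈ Complex.slitPlane) (f : L2Space d) :
    dilation d s (freeResolvent d w f) =
      Complex.exp (2 * s) • freeResolvent d (Complex.exp (2 * s) * w) (dilation d s f) := by
  obtain ⟨hm, he, -⟩ := freeHamiltonian_add_freeResolvent hw f
  obtain ⟨hm', he'⟩ := freeHamiltonian_dilation s ⟨_, hm⟩
  have h := (freeResolvent_spec (isResolventPoint_freeHamiltonian (d := d) hw')).2 ⟨_, hm'⟩
  rw [he', he, map_add, map_smul] at h
  simp only at h
  refine h.symm.trans ((congrArg _ ?_).trans (map_smul _ (Complex.exp (2 * s)) _))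
  module

theorem shiftedResolvent_domain {w : ℂ} (hw : -w ∈ Complex.slitPlane)
    (u : (freeHamiltonian d).domain) :
    shiftedResolvent d w u = freeResolvent d w (freeHamiltonian d u + u) := by
  have h := (freeResolvent_spec (isResolventPoint_freeHamiltonian (d := d) hw)).2 u
  have h1 : freeHamiltonian d u + u =
      (freeHamiltonian d u - w • (u : L2Space d)) + (w + 1) • (u : L2Space d) := by module
  rw [h1, map_add, h, map_smul, shiftedResolvent_apply]

/-- On u in H² the operator gives (H₀ - z)⁻¹(H₀+1)u, of norm at most |Im z|⁻¹‖(H₀+1)u‖. Density of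
H² and the uniform bound C extend the limit to every f. -/
theorem tendsto_shiftedResolvent {z : ℕ → ℂ} {C : ℝ} (hz : ∀ n, (z n).im ≠ 0)
    (hC : ∀ n, ‖shiftedResolvent d (z n)‖ ≤ C)
    (hlim : Tendsto (fun n => |(z n).im|⁻¹) atTop (𝓝 0)) (f : L2Space d) :
    Tendsto (fun n => shiftedResolvent d (z n) f) atTop (𝓝 0) := by
  have hslit : ∀ n, -z n ∈ Complex.slitPlane := fun n =>
    Complex.mem_slitPlane_iff.mpr (Or.inr (by simpa using hz n))
  have hC0 : 0 ≤ C := (norm_nonneg _).trans (hC 0)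
  rw [Metric.tendsto_atTop]
  intro ε hε
  obtain ⟨u, hu, hfu⟩ := Metric.dense_iff.mp (freeHamiltonian_dense (d := d)) f
    (ε / (2 * (C + 1))) (by positivity)
  rw [Metric.mem_ball, dist_comm, dist_eq_norm] at hu
  lift u to (freeHamiltonian d).domain using hfu
  have hlim' := hlim.mul_const ‖freeHamiltonian d u + u‖
  rw [zero_mul, Metric.tendsto_atTop] at hlim'
  obtain ⟨N, hN⟩ := hlim' (ε / 2) (half_pos hε)
  refine ⟨N, fun n hn => ?_⟩
  have h1 := hN n hn
  rw [Real.dist_eq, sub_zero, abs_of_nonneg (by positivity)] at h1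
  have h2 : ‖shiftedResolvent d (z n) (u : L2Space d)‖ < ε / 2 := by
    rw [shiftedResolvent_domain (hslit n)]
    exact ((freeResolvent d (z n)).le_of_opNorm_le (norm_freeResolvent_le (hz n)) _).trans_lt h1
  have h3 : ‖shiftedResolvent d (z n) (f - u)‖ ≤ ε / 2 := by
    refine ((shiftedResolvent d (z n)).le_of_opNorm_le (hC n) _).trans ?_
    calc C * ‖f - u‖ ≤ (C + 1) * (ε / (2 * (C + 1))) := by gcongr; linarith
      _ = ε / 2 := by field_simp
  rw [dist_zero_right]
  calc ‖shiftedResolvent d (z n) f‖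
      = ‖shiftedResolvent d (z n) (f - u) + shiftedResolvent d (z n) (u : L2Space d)‖ := by
        rw [← map_add, sub_add_cancel]
    _ ≤ _ := norm_add_le _ _
    _ < ε := by linarith

/-- Far from the spectrum, `1 + A (H₀ + 1)(H₀ - z)⁻¹` is invertible for compact `A`. -/
theorem exists_isUnit_one_add_mul_shiftedResolvent {A : L2Space d →L[ℂ] L2Space d}
    (hA : IsCompactOperator A) {σ : ℝ} (hσ : |σ| = 1) :
    ∃ z : ℂ, 0 < σ * z.im ∧ IsUnit (1 + A * shiftedResolvent d z) := by
  have hσ2 : σ * σ = 1 := by rw [← abs_mul_abs_self, hσ, one_mul]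
  by_contra hcon
  push Not at hcon
  let z : ℕ → ℂ := fun n => ((σ * (n + 1) : ℝ) : ℂ) * Complex.I
  have him : ∀ n, (z n).im = σ * (n + 1) := fun n => by simp [z]
  have habs : ∀ n, |(z n).im| = n + 1 := fun n => by
    rw [him, abs_mul, hσ, one_mul, abs_of_nonneg (by positivity)]
  have hne : ∀ n, (z n).im ≠ 0 := fun n => by
    rw [← abs_pos, habs]; positivity
  -- For z = ±i(n+1) the norm is at most 1 + |z+1|/|Im z| ≤ 1 + (n+2)/(n+1) ≤ 3.
  have hC : ∀ n, ‖shiftedResolvent d (z n)‖ ≤ 3 := fun n => by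
    have hnorm : ‖z n‖ = n + 1 := by
      simp only [z]
      rw [norm_mul, Complex.norm_I, mul_one, Complex.norm_real, norm_mul, Real.norm_eq_abs, hσ,
        one_mul, Real.norm_of_nonneg (by positivity)]
    have h1 : ‖freeResolvent d (z n)‖ ≤ ((n : ℝ) + 1)⁻¹ := by
      rw [← habs]; exact norm_freeResolvent_le (hne n)
    have h2 : ‖z n + 1‖ ≤ n + 2 := by
      refine (norm_add_le _ _).trans ?_
      rw [hnorm, norm_one]; linarith
    calc ‖shiftedResolvent d (z n)‖ ≤ ‖(1 : L2Space d →L[ℂ] L2Space d)‖ +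
          ‖(z n + 1) • freeResolvent d (z n)‖ := norm_add_le _ _
      _ ≤ 1 + (n + 2) * ((n : ℝ) + 1)⁻¹ := by
        rw [norm_smul]
        exact add_le_add ContinuousLinearMap.norm_id_le
          (mul_le_mul h2 h1 (norm_nonneg _) (by positivity))
      _ ≤ 3 := by
        have : ((n : ℝ) + 2) * ((n : ℝ) + 1)⁻¹ ≤ 2 := by
          rw [← div_eq_mul_inv, div_le_iff₀ (by positivity)]
          linarith [(n.cast_nonneg : (0 : ℝ) ≤ n)]
        linarith
  have hlim : Tendsto (fun n => |(z n).im|⁻¹) atTop (𝓝 0) := by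
    simp only [habs]
    simpa [one_div] using tendsto_one_div_add_atTop_nhds_zero_nat (𝕜 := ℝ)
  -- If invertibility always failed, there would be unit vectors with g = -A J g, where J =
  -- (H₀+1)(H₀-z)⁻¹. Compactness of A makes a subsequence of them converge; the strong limit J → 0
  -- with bounded norms then forces g → 0, a contradiction.
  have hex : ∀ n, ∃ g : L2Space d, ‖g‖ = 1 ∧ g + A (shiftedResolvent d (z n) g) = 0 := by
    intro n
    have hn : ¬ IsUnit (1 + A * shiftedResolvent d (z n)) :=
      hcon (z n) (by rw [him, ← mul_assoc, hσ2]; positivity)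
    obtain ⟨g, hg0, hg⟩ := IsCompactOperator.exists_ker_of_not_isUnit
      (hA.comp_clm (shiftedResolvent d (z n))) hn
    refine ⟨((‖g‖⁻¹ : ℝ) : ℂ) • g, ?_, ?_⟩
    · rw [norm_smul, Complex.norm_real, norm_inv, norm_norm,
        inv_mul_cancel₀ (norm_ne_zero_iff.mpr hg0)]
    · rw [map_smul, map_smul, ← smul_add]
      rw [mul_apply_eq_comp] at hg
      rw [hg, smul_zero]
  choose g hg1 hg using hex
  obtain ⟨Q, hQ, hsub⟩ :=
    hA.image_closedBall_subset_compact (f := (A : L2Space d →ₗ[ℂ] L2Space d)) 3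
  have hmem : ∀ n, A (shiftedResolvent d (z n) (g n)) ∈ Q := fun n => hsub ⟨_, by
    rw [Metric.mem_closedBall, dist_zero_right]
    simpa [hg1] using (shiftedResolvent d (z n)).le_of_opNorm_le (hC n) (g n), rfl⟩
  obtain ⟨y, -, ψ, hψ, hlimy⟩ := hQ.tendsto_subseq hmem
  have hgn : ∀ n, g n = -A (shiftedResolvent d (z n) (g n)) := fun n =>
    eq_neg_of_add_eq_zero_left (hg n)
  have hgy : Tendsto (fun n => g (ψ n)) atTop (𝓝 (-y)) := by
    refine hlimy.neg.congr fun n => ?_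
    exact (hgn (ψ n)).symm
  have hJ : Tendsto (fun n => shiftedResolvent d (z (ψ n)) (g (ψ n))) atTop (𝓝 0) := by
    have h1 : Tendsto (fun n => shiftedResolvent d (z (ψ n)) (-y)) atTop (𝓝 0) :=
      (tendsto_shiftedResolvent hne hC hlim (-y)).comp hψ.tendsto_atTop
    have h2 : Tendsto (fun n => shiftedResolvent d (z (ψ n)) (g (ψ n) - -y)) atTop (𝓝 0) := by
      have h3 : Tendsto (fun n => 3 * ‖g (ψ n) - -y‖) atTop (𝓝 0) := by
        have := (tendsto_iff_norm_sub_tendsto_zero.mp hgy).const_mul 3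
        rwa [mul_zero] at this
      exact squeeze_zero_norm (fun n => (shiftedResolvent d _).le_of_opNorm_le (hC _) _) h3
    have := h2.add h1
    rw [zero_add] at this
    refine this.congr fun n => ?_
    rw [← map_add, sub_add_cancel]
  have hy0 : Tendsto (fun n => g (ψ n)) atTop (𝓝 0) := by
    have := ((A.continuous.tendsto 0).comp hJ).neg
    rw [map_zero, neg_zero] at this
    exact this.congr fun n => (hgn (ψ n)).symm
  have := hy0.norm
  simp only [hg1, norm_zero] at this
  exact one_ne_zero (tendsto_nhds_unique tendsto_const_nhds this)

end FreeResolvent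

/-! ### The Birman–Schwinger family of the dilated operators -/

section Dilated

variable {d : ℕ}

/-- `V_θ (e^{-2θ} H₀ - z)⁻¹` where `A = V_θ (H₀ + 1)⁻¹`. -/
def birmanSchwinger (A : L2Space d →L[ℂ] L2Space d) (θ z : ℂ) : L2Space d →L[ℂ] L2Space d :=
  Complex.exp (2 * θ) • (A * shiftedResolvent d (Complex.exp (2 * θ) * z))

/-- Since e^{-2θ}H₀ - z = e^{-2θ}(H₀ - e^{2θ}z), its inverse is e^{2θ}(H₀ - e^{2θ}z)⁻¹, and V_θ
applied to this gives the Birman–Schwinger operator. -/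
theorem dilatedSchrodingerOperator_factorization {W : Space d → ℂ}
    {A : L2Space d →L[ℂ] L2Space d} (hA : IsResolventProduct W A) {θ z : ℂ}
    (hz : -(Complex.exp (2 * θ) * z) ∈ Complex.slitPlane) (f : L2Space d) :
    ∃ h : (Complex.exp (2 * θ) • freeResolvent d (Complex.exp (2 * θ) * z)) f ∈
        (dilatedSchrodingerOperator θ W).domain,
      dilatedSchrodingerOperator θ W ⟨_, h⟩ -
        z • (Complex.exp (2 * θ) • freeResolvent d (Complex.exp (2 * θ) * z)) f =
          f + birmanSchwinger A θ z f := by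
  obtain ⟨hm, he, hs⟩ := freeHamiltonian_add_freeResolvent hz f
  obtain ⟨hW, hWA⟩ := hA ⟨_, hm⟩
  rw [hs] at hWA
  set u := freeResolvent d (Complex.exp (2 * θ) * z) f
  have hm' : Complex.exp (2 * θ) • u ∈ (freeHamiltonian d).domain := Submodule.smul_mem _ _ hm
  have hW' : Complex.exp (2 * θ) • u ∈ (multiplicationOperator W).domain :=
    Submodule.smul_mem _ _ hW
  refine ⟨⟨hm', hW'⟩, ?_⟩
  have h1 : freeHamiltonian d ⟨_, hm'⟩ = Complex.exp (2 * θ) • freeHamiltonian d ⟨u, hm⟩ :=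
    (freeHamiltonian d).map_smul _ ⟨u, hm⟩
  have h2 : multiplicationOperator W ⟨_, hW'⟩ =
      Complex.exp (2 * θ) • multiplicationOperator W ⟨u, hW⟩ :=
    (multiplicationOperator W).map_smul _ ⟨u, hW⟩
  change Complex.exp (-2 * θ) • freeHamiltonian d ⟨_, hm'⟩ + multiplicationOperator W ⟨_, hW'⟩ -
    z • Complex.exp (2 * θ) • u = _
  rw [h1, h2, he, ← hWA, smul_smul, ← Complex.exp_add]
  have h3 : -2 * θ + 2 * θ = 0 := by ring
  rw [h3, Complex.exp_zero, birmanSchwinger, smul_apply, mul_apply_eq_comp]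
  module

theorem isFredholmFactorization_dilated {W : Space d → ℂ}
    {A : L2Space d →L[ℂ] L2Space d} (hA : IsResolventProduct W A) {θ : ℂ} {S : Set ℂ}
    (hSo : IsOpen S) (hSc : IsPreconnected S)
    (hS : ∀ z ∈ S, -(Complex.exp (2 * θ) * z) ∈ Complex.slitPlane)
    (hc : ∀ z ∈ S, IsCompactOperator (birmanSchwinger A θ z)) :
    IsFredholmFactorization (dilatedSchrodingerOperator θ W) S
      (fun z => Complex.exp (2 * θ) • freeResolvent d (Complex.exp (2 * θ) * z))
      (birmanSchwinger A θ) where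
  isOpen := hSo
  isPreconnected := hSc
  analytic_left z hz := by
    have h : AnalyticAt ℂ (fun w => freeResolvent d (Complex.exp (2 * θ) * w)) z :=
      (freeResolvent_analyticAt (hS z hz)).comp_of_eq (analyticAt_const.mul analyticAt_id) rfl
    have hc : AnalyticAt ℂ (fun _ : ℂ => Complex.exp (2 * θ)) z := analyticAt_const
    exact hc.smul h
  analytic_right z hz := by
    have h : AnalyticAt ℂ (fun w => shiftedResolvent d (Complex.exp (2 * θ) * w)) z :=
      (shiftedResolvent_analyticAt (hS z hz)).comp_of_eq (analyticAt_const.mul analyticAt_id) rfl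
    have hc : AnalyticAt ℂ (fun _ : ℂ => Complex.exp (2 * θ)) z := analyticAt_const
    have hA : AnalyticAt ℂ (fun _ : ℂ => A) z := analyticAt_const
    exact hc.smul (hA.mul h)
  compact := hc
  mem_domain z hz f := dilatedSchrodingerOperator_factorization hA (hS z hz) f
  surj z hz u := by
    have h := (freeResolvent_spec (isResolventPoint_freeHamiltonian (d := d) (hS z hz))).2
      ⟨u, u.2.1⟩
    refine ⟨Complex.exp (-2 * θ) • (freeHamiltonian d ⟨u, u.2.1⟩ -
      (Complex.exp (2 * θ) * z) • (u : L2Space d)), ?_⟩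
    rw [smul_apply, map_smul, h, smul_smul, ← Complex.exp_add]
    simp
  inj z hz g hg := by
    rw [smul_apply, smul_eq_zero_iff_right (Complex.exp_ne_zero _)] at hg
    obtain ⟨hm, he, -⟩ := freeHamiltonian_add_freeResolvent (hS z hz) g
    have h0 : (⟨_, hm⟩ : (freeHamiltonian d).domain) = 0 := Subtype.ext hg
    rw [h0, LinearPMap.map_zero, hg, smul_zero, add_zero] at he
    exact he.symm

/-- Conjugation by the dilation e^s sends V_t to V_{t+s} and e^{-2t}H₀ to e^{-2(t+s)}H₀, while z
stays fixed. -/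
theorem dilation_birmanSchwinger {V : Space d → ℂ} {G : ℂ → (L2Space d →L[ℂ] L2Space d)}
    (hGV : ∀ t : ℝ, IsResolventProduct (realDilation V t) (G (t : ℂ))) (s t : ℝ) {z : ℂ}
    (hz : ∀ r : ℝ, -(Complex.exp (2 * r) * z) ∈ Complex.slitPlane) :
    dilation d s * birmanSchwinger (G t) t z =
      birmanSchwinger (G ((t + s : ℝ) : ℂ)) ((t + s : ℝ) : ℂ) z * dilation d s := by
  have hexp : Complex.exp (2 * ((t + s : ℝ) : ℂ)) =
      Complex.exp (2 * s) * Complex.exp (2 * t) := by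
    rw [← Complex.exp_add]; congr 1; push_cast; ring
  ext1 f
  set w := Complex.exp (2 * t) * z with hw
  have hws : Complex.exp (2 * ((t + s : ℝ) : ℂ)) * z = Complex.exp (2 * s) * w := by
    rw [hexp, hw, mul_assoc]
  have hz' := hz (t + s)
  rw [hws] at hz'
  obtain ⟨hm, he, hs⟩ := freeHamiltonian_add_freeResolvent (hz t) f
  obtain ⟨hW, hWA⟩ := hGV t ⟨_, hm⟩
  rw [hs] at hWA
  obtain ⟨hW', hWA'⟩ := multiplicationOperator_dilation (W' := realDilation V (t + s)) (s := s)
    (Eventually.of_forall fun x => by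
      simp only [realDilation]
      rw [smul_smul, ← Real.exp_add]) ⟨_, hW⟩
  obtain ⟨hm', he', hs'⟩ := freeHamiltonian_add_freeResolvent hz'
    (Complex.exp (2 * s) • dilation d s f)
  obtain ⟨hW'', hWA''⟩ := hGV (t + s) ⟨_, hm'⟩
  rw [hs'] at hWA''
  have hcov : dilation d s (freeResolvent d w f) =
      freeResolvent d (Complex.exp (2 * s) * w) (Complex.exp (2 * s) • dilation d s f) := by
    rw [map_smul]
    exact dilation_freeResolvent (hz t) s hz' f
  have hmul : multiplicationOperator (realDilation V (t + s)) ⟨_, hW'⟩ =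
      multiplicationOperator (realDilation V (t + s)) ⟨_, hW''⟩ := by
    congr 1
    exact Subtype.ext hcov
  rw [mul_apply_eq_comp, mul_apply_eq_comp, birmanSchwinger, birmanSchwinger, smul_apply,
    smul_apply, mul_apply_eq_comp, mul_apply_eq_comp, map_smul, hWA, ← hWA', hmul, ← hWA'', hws,
    hexp, map_smul, map_smul, smul_smul, mul_comm]

theorem birmanSchwinger_analyticAt {G : ℂ → (L2Space d →L[ℂ] L2Space d)} {θ z : ℂ}
    (hG : AnalyticAt ℂ G θ) (hz : -(Complex.exp (2 * θ) * z) ∈ Complex.slitPlane) :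
    AnalyticAt ℂ (fun ϑ => birmanSchwinger (G ϑ) ϑ z) θ := by
  have h1 : AnalyticAt ℂ (fun ϑ : ℂ => Complex.exp (2 * ϑ)) θ := by fun_prop
  exact h1.smul (hG.mul ((shiftedResolvent_analyticAt hz).comp_of_eq
    (h1.mul analyticAt_const) rfl))

/-- Compactness of the Birman–Schwinger family, and independence of its invertibility from the
dilation parameter, over a connected translation-invariant set of parameters. -/
theorem birmanSchwinger_compact_and_isUnit_iff {α : ℝ} {V : Space d → ℂ}
    {G : ℂ → (L2Space d →L[ℂ] L2Space d)} (hG : AnalyticOnNhd ℂ G (dilationStrip α))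
    (hGV : ∀ t : ℝ, IsResolventProduct (realDilation V t) (G (t : ℂ)))
    (hG0 : IsCompactOperator (G 0)) {D : Set ℂ} (hD : IsPreconnected D) (hDα : D ⊆ dilationStrip α)
    (hDt : ∀ θ ∈ D, ∀ t : ℝ, θ + t ∈ D) (h0 : (0 : ℂ) ∈ D) {z : ℂ}
    (hz : ∀ θ ∈ D, -(Complex.exp (2 * θ) * z) ∈ Complex.slitPlane) :
    (∀ θ ∈ D, IsCompactOperator (birmanSchwinger (G θ) θ z)) ∧
    ∀ θ₁ ∈ D, ∀ θ₂ ∈ D, IsUnit (1 + birmanSchwinger (G θ₁) θ₁ z) →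
      IsUnit (1 + birmanSchwinger (G θ₂) θ₂ z) := by
  have hreal : ∀ t : ℝ, (t : ℂ) ∈ D := fun t => by simpa using hDt 0 h0 t
  have han : AnalyticOnNhd ℂ (fun θ => birmanSchwinger (G θ) θ z) D := fun θ hθ =>
    birmanSchwinger_analyticAt (hG θ (hDα hθ)) (hz θ hθ)
  have hcov : ∀ s t : ℝ, dilation d s * birmanSchwinger (G t) t z =
      birmanSchwinger (G ((t + s : ℝ) : ℂ)) ((t + s : ℝ) : ℂ) z * dilation d s := fun s t =>
    dilation_birmanSchwinger hGV s t fun r => hz r (hreal r)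
  have hcomp : ∀ θ ∈ D, IsCompactOperator (birmanSchwinger (G θ) θ z) := by
    intro θ hθ
    -- At real t the operator is conjugate to the one at 0, compact by hypothesis; the reals
    -- accumulate at 0, so compactness spreads over D.
    refine han.isCompactOperator_of_frequently hD h0 (frequently_punctured_of_real fun t => ?_) hθ
    have h1 := hcov t 0
    rw [zero_add] at h1
    have h2 : birmanSchwinger (G (t : ℂ)) t z =
        dilation d t * birmanSchwinger (G ((0 : ℝ) : ℂ)) ((0 : ℝ) : ℂ) z * dilation d (-t) := by
      rw [h1, mul_assoc, dilation_mul_neg, mul_one]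
    rw [h2]
    have h3 : IsCompactOperator (birmanSchwinger (G ((0 : ℝ) : ℂ)) ((0 : ℝ) : ℂ) z) := by
      rw [Complex.ofReal_zero]
      exact (hG0.comp_clm (shiftedResolvent d _)).smul (Complex.exp (2 * 0))
    exact (h3.clm_comp (dilation d t)).comp_clm (dilation d (-t))
  refine ⟨hcomp, fun θ₁ h₁ θ₂ h₂ hu => ?_⟩
  -- The Fredholm theorem, in the variable θ, may miss θ₂ itself, but it does reach nearby real
  -- translates of θ₂.
  have hev := han.eventually_isUnit_one_add hD hcomp h₁ hu h₂
  obtain ⟨s, hs⟩ : ∃ s : ℝ, IsUnit (1 + birmanSchwinger (G (θ₂ + s)) (θ₂ + s) z) := by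
    have ht : Tendsto (fun s : ℝ => θ₂ + (s : ℂ)) (𝓝[≠] 0) (𝓝[≠] θ₂) := by
      refine tendsto_nhdsWithin_iff.mpr ⟨?_, ?_⟩
      · have : Continuous fun s : ℝ => θ₂ + (s : ℂ) := by fun_prop
        have h := this.tendsto 0
        rw [Complex.ofReal_zero, add_zero] at h
        exact h.mono_left nhdsWithin_le_nhds
      · filter_upwards [self_mem_nhdsWithin] with t ht
        simpa using ht
    exact (ht.eventually hev).exists
  -- For fixed real s both sides are analytic in θ on the translation-invariant set D, so the
  -- intertwining continues from the real line to θ₂.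
  have hgen : dilation d s * birmanSchwinger (G θ₂) θ₂ z =
      birmanSchwinger (G (θ₂ + s)) (θ₂ + s) z * dilation d s := by
    have a₁ : AnalyticOnNhd ℂ (fun θ => dilation d s * birmanSchwinger (G θ) θ z) D :=
      fun θ hθ => analyticAt_const.mul (han θ hθ)
    have a₂ : AnalyticOnNhd ℂ
        (fun θ => birmanSchwinger (G (θ + s)) (θ + s) z * dilation d s) D :=
      fun θ hθ => ((han (θ + s) (hDt θ hθ s)).comp_of_eq
        (f := fun θ : ℂ => θ + (s : ℂ)) (analyticAt_id.add analyticAt_const) rfl).mul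
        analyticAt_const
    refine a₁.eq_of_eq_real a₂ hD h0 (fun t => ?_) h₂
    rw [← Complex.ofReal_add]
    exact hcov s t
  have hconj : 1 + birmanSchwinger (G θ₂) θ₂ z =
      dilation d (-s) * (1 + birmanSchwinger (G (θ₂ + s)) (θ₂ + s) z) * dilation d s := by
    rw [mul_add, mul_one, add_mul, dilation_neg_mul, mul_assoc, ← hgen, ← mul_assoc,
      dilation_neg_mul, one_mul]
  let U : (L2Space d →L[ℂ] L2Space d)ˣ :=
    ⟨dilation d s, dilation d (-s), dilation_mul_neg s, dilation_neg_mul s⟩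
  rw [hconj]
  exact ((U⁻¹).isUnit.mul hs).mul U.isUnit

end Dilated

/-! ### Geometry of the spectral parameters -/

section Parameters

/-- An argument of e^{2θ}z is arg z + 2 Im θ; lying strictly between 0 and 2π, or between -2π and 0,
it avoids [0,∞). The sign σ covers both half-planes. -/
theorem neg_exp_mul_mem_slitPlane {θ z : ℂ} {σ : ℝ} (hσ : |σ| = 1) (hz : z ≠ 0)
    (h₁ : 0 < σ * (z.arg + 2 * θ.im)) (h₂ : σ * (z.arg + 2 * θ.im) < 2 * Real.pi) :
    -(Complex.exp (2 * θ) * z) ∈ Complex.slitPlane := by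
  set ϕ := z.arg + 2 * θ.im with hϕ
  have hpos : 0 < ‖z‖ * Real.exp (2 * θ.re) := mul_pos (norm_pos_iff.mpr hz) (Real.exp_pos _)
  have heq : Complex.exp (2 * θ) * z =
      ((‖z‖ * Real.exp (2 * θ.re) : ℝ) : ℂ) * Complex.exp (ϕ * Complex.I) := by
    have h := Complex.norm_mul_exp_arg_mul_I z
    have h2 : (2 * θ : ℂ) = ((2 * θ.re : ℝ) : ℂ) + ((2 * θ.im : ℝ) : ℂ) * Complex.I := by
      conv_lhs => rw [← Complex.re_add_im θ]
      push_cast; ring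
    nth_rw 1 [← h]
    rw [h2, Complex.exp_add, hϕ, Complex.ofReal_mul ‖z‖, Complex.ofReal_exp, Complex.ofReal_add,
      add_mul, Complex.exp_add]
    ring
  by_contra hcon
  rw [Complex.mem_slitPlane_iff, heq] at hcon
  push Not at hcon
  simp only [Complex.neg_re, Complex.neg_im, Complex.re_ofReal_mul, Complex.im_ofReal_mul,
    Complex.exp_ofReal_mul_I_re, Complex.exp_ofReal_mul_I_im] at hcon
  have hsin : Real.sin ϕ = 0 := by
    rcases mul_eq_zero.mp (neg_eq_zero.mp hcon.2) with h | h
    · exact absurd h hpos.ne'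
    · exact h
  have hcos : 0 ≤ Real.cos ϕ := by
    have : 0 ≤ ‖z‖ * Real.exp (2 * θ.re) * Real.cos ϕ := by linarith [hcon.1]
    exact (mul_nonneg_iff_of_pos_left hpos).mp this
  have hcos1 : Real.cos ϕ = 1 := by
    nlinarith [Real.sin_sq_add_cos_sq ϕ]
  have habs : |ϕ| < 2 * Real.pi := by
    have : |σ * ϕ| < 2 * Real.pi := by rwa [abs_of_pos h₁]
    rwa [abs_mul, hσ, one_mul] at this
  have h0 := (Real.cos_eq_one_iff_of_lt_of_lt (abs_lt.mp habs).1 (abs_lt.mp habs).2).mp hcos1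
  rw [h0, mul_zero] at h₁
  exact lt_irrefl _ h₁

theorem sign_mul_arg_mem {z : ℂ} {σ : ℝ} (hσ : |σ| = 1) (hz : 0 < σ * z.im) :
    0 < σ * z.arg ∧ σ * z.arg < Real.pi := by
  rcases (abs_eq zero_le_one).mp hσ with rfl | rfl
  · rw [one_mul] at hz ⊢
    refine ⟨?_, ?_⟩
    · exact (Complex.arg_nonneg_iff.mpr hz.le).lt_of_ne fun h =>
        hz.ne' (Complex.arg_eq_zero_iff.mp h.symm).2
    · exact (Complex.arg_le_pi z).lt_of_ne fun h => hz.ne' (Complex.arg_eq_pi_iff.mp h).2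
  · have hz' : z.im < 0 := by linarith
    have h1 := Complex.arg_neg_iff.mpr hz'
    have h2 := Complex.neg_pi_lt_arg z
    constructor <;> linarith

end Parameters

/-! ### The discrete spectrum of the dilated operators -/

/-- This places H in the dilated family at θ = 0, where the continued potential is only known to
equal V a.e. -/
theorem schrodingerOperator_eq_dilated {d : ℕ} {V W : Space d → ℂ} (h : V =ᵐ[volume] W) :
    schrodingerOperator V = dilatedSchrodingerOperator 0 W := by
  have hmul : multiplicationOperator V = multiplicationOperator W := by
    have hfun : ∀ u : L2Space d, (fun x => V x * u x) =ᵐ[volume] fun x => W x * u x := fun u => by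
      filter_upwards [h] with x hx
      rw [hx]
    refine LinearPMap.ext ?_ ?_
    · ext u
      exact ⟨fun hu : MemLp _ 2 volume => hu.ae_eq (hfun u),
        fun hu : MemLp _ 2 volume => hu.ae_eq (hfun u).symm⟩
    · intro u hu hu'
      exact MemLp.toLp_congr hu hu' (hfun u)
  rw [schrodingerOperator, dilatedSchrodingerOperator, hmul, mul_zero, Complex.exp_zero, one_smul]

theorem isCompactOperator_of_isResolventProduct {d : ℕ} {V : Space d → ℂ}
    {K A : L2Space d →L[ℂ] L2Space d} (hK : IsResolventProduct V K) (hc : IsCompactOperator K)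
    (hA : IsResolventProduct V A) : IsCompactOperator A := by
  have : A = K := by
    ext1 f
    obtain ⟨hm, he⟩ :=
      (freeResolvent_spec (isResolventPoint_freeHamiltonian (d := d) neg_one_resolvent)).1 f
    obtain ⟨h1, h2⟩ := hK ⟨_, hm⟩
    obtain ⟨h3, h4⟩ := hA ⟨_, hm⟩
    rw [neg_smul, one_smul, sub_neg_eq_add] at he
    rw [he] at h2 h4
    rw [h2, h4]
  rwa [this]

theorem mem_discreteSpectrum_dilated_iff {d : ℕ} {γ : ℝ} [Fact (1 ≤ γ)] {α : ℝ} (hα : 0 < α)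
    (hα' : α < Real.pi / 2) {V : Space d → ℂ} (hV : IsDilationAnalytic γ α V)
    {F : ℂ → Lp ℂ (potentialExponent d γ) (volume : Measure (Space d))}
    (hF : IsDilationContinuation γ α V F) {θ : ℂ} (hθ : θ ∈ dilationStrip α) {lam : ℂ}
    {σ : ℝ} (hσ : |σ| = 1) (hθσ : 0 < σ * θ.im) (hlam : 0 < σ * lam.im) :
    lam ∈ discreteSpectrum (schrodingerOperator V) ↔
      lam ∈ discreteSpectrum (dilatedSchrodingerOperator θ (F θ)) := by
  obtain ⟨G, hG, hGV⟩ := hV.resolvent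
  obtain ⟨K, hKV, hK⟩ := hV.relCompact
  have hV0 : realDilation V 0 = V := by
    ext x; simp [realDilation]
  have h0strip : (0 : ℂ) ∈ dilationStrip α := by simpa using ofReal_mem_dilationStrip hα 0
  have hG0 : IsCompactOperator (G 0) := by
    have := hGV 0
    rw [hV0, Complex.ofReal_zero] at this
    exact isCompactOperator_of_isResolventProduct hKV hK this
  have hFV : V =ᵐ[volume] F 0 := by
    have := hF.eq_real 0
    rw [hV0, Complex.ofReal_zero] at this
    exact this.symm
  rw [schrodingerOperator_eq_dilated hFV]
  let S : Set ℂ := {z | 0 < σ * z.im}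
  have hSo : IsOpen S := isOpen_lt continuous_const (continuous_const.mul Complex.continuous_im)
  have hSc : IsPreconnected S := by
    have : S = (σ • Complex.imLm) ⁻¹' Set.Ioi 0 := by
      ext z; simp [S]
    rw [this]
    exact ((convex_Ioi 0).linear_preimage _).isPreconnected
  have hne : ∀ z ∈ S, z ≠ 0 := by
    rintro z hz rfl
    simp [S] at hz
  -- For z in the half-plane, the strict inequality holds with room to spare at ϑ = 0. Hence D z is
  -- an open convex set around the whole real line, as continuation from real parameters requires,
  -- and it contains every ϑ of the strip with σ Im ϑ ≥ 0.
  let D : ℂ → Set ℂ := fun z => {ϑ | 0 < σ * (z.arg + 2 * ϑ.im)} ∩ dilationStrip α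
  have hD : ∀ z, IsPreconnected (D z) := fun z => by
    have : {ϑ : ℂ | 0 < σ * (z.arg + 2 * ϑ.im)} =
        ((2 * σ) • Complex.imLm) ⁻¹' Set.Ioi (-(σ * z.arg)) := by
      ext ϑ
      simp only [Set.mem_ofPred_eq, Set.mem_preimage, Set.mem_Ioi, LinearMap.smul_apply,
        Complex.imLm_coe, smul_eq_mul]
      constructor <;> intro h <;> linarith
    exact ((this ▸ (convex_Ioi _).linear_preimage _ : Convex ℝ _).inter
      (dilationStrip_convex α)).isPreconnected
  have hDt : ∀ z, ∀ ϑ ∈ D z, ∀ t : ℝ, ϑ + t ∈ D z := fun z ϑ hϑ t => by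
    simpa [D, dilationStrip] using hϑ
  have hσle : ∀ x : ℝ, σ * x ≤ |x| := fun x => by
    have := le_abs_self (σ * x)
    rwa [abs_mul, hσ, one_mul] at this
  have hslit : ∀ z ∈ S, ∀ ϑ ∈ D z, -(Complex.exp (2 * ϑ) * z) ∈ Complex.slitPlane := by
    intro z hz ϑ hϑ
    refine neg_exp_mul_mem_slitPlane hσ (hne z hz) hϑ.1 ?_
    have h1 := (sign_mul_arg_mem hσ hz).2
    have h2 : |ϑ.im| < α := hϑ.2
    have h3 := hσle ϑ.im
    -- Here α < π/2 enters: σ arg z < π and 2σ Im ϑ < 2α < π add up to less than 2π.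
    linarith
  have hmem : ∀ ϑ ∈ dilationStrip α, 0 ≤ σ * ϑ.im → ∀ z ∈ S, ϑ ∈ D z := by
    intro ϑ hϑ hϑσ z hz
    refine ⟨?_, hϑ⟩
    have h1 := (sign_mul_arg_mem hσ hz).1
    change 0 < σ * (z.arg + 2 * ϑ.im)
    linarith
  have hmem0 : ∀ z ∈ S, (0 : ℂ) ∈ D z := hmem 0 h0strip (by simp)
  have hmain := fun z (hz : z ∈ S) => birmanSchwinger_compact_and_isUnit_iff hG hGV hG0 (hD z)
    Set.inter_subset_right (hDt z) (hmem0 z hz) (hslit z hz)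
  obtain ⟨z₁, hz₁, hu₁⟩ := exists_isUnit_one_add_mul_shiftedResolvent hG0 hσ
  have hu₀ : IsUnit (1 + birmanSchwinger (G 0) 0 z₁) := by
    simpa [birmanSchwinger] using hu₁
  -- Stated with σ Im ϑ ≥ 0 so that it covers both ϑ = 0, which is H, and ϑ = θ.
  have hkey : ∀ ϑ ∈ dilationStrip α, 0 ≤ σ * ϑ.im →
      (lam ∈ discreteSpectrum (dilatedSchrodingerOperator ϑ (F ϑ)) ↔
        ¬ IsUnit (1 + birmanSchwinger (G ϑ) ϑ lam)) := by
    intro ϑ hϑ hϑσ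
    have hA := isResolventProduct_continuation hα hF hG hGV hϑ
    have hfac := isFredholmFactorization_dilated hA hSo hSc
      (fun z hz => hslit z hz ϑ (hmem ϑ hϑ hϑσ z hz))
      (fun z hz => (hmain z hz).1 ϑ (hmem ϑ hϑ hϑσ z hz))
    exact hfac.mem_discreteSpectrum_iff hz₁
      ((hmain z₁ hz₁).2 0 (hmem0 z₁ hz₁) ϑ (hmem ϑ hϑ hϑσ z₁ hz₁) hu₀) hlam
  rw [hkey 0 h0strip (by simp), hkey θ hθ hθσ.le, not_iff_not]
  have hθD := hmem θ hθ hθσ.le lam hlam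
  exact ⟨(hmain lam hlam).2 0 (hmem0 lam hlam) θ hθD, (hmain lam hlam).2 θ hθD 0 (hmem0 lam hlam)⟩

end

theorem lemma3p1 (d : ℕ) (hd : 1 ≤ d) (γ : ℝ) [Fact (1 ≤ γ)] (α : ℝ) (hα : 0 < α)
    (hα' : α < Real.pi / 2) (V : Space d → ℂ) (hV : IsDilationAnalytic γ α V)
    (F : ℂ → Lp ℂ (potentialExponent d γ) (volume : Measure (Space d)))
    (hF : IsDilationContinuation γ α V F) (θ : ℂ) (hθ : θ ∈ dilationStrip α) (lam : ℂ) :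
    (0 < θ.im → 0 < lam.im →
      (lam ∈ discreteSpectrum (schrodingerOperator V) ↔
        lam ∈ discreteSpectrum (dilatedSchrodingerOperator θ (F θ)))) ∧
    (θ.im < 0 → lam.im < 0 →
      (lam ∈ discreteSpectrum (schrodingerOperator V) ↔
        lam ∈ discreteSpectrum (dilatedSchrodingerOperator θ (F θ)))) :=
  ⟨fun h₁ h₂ => mem_discreteSpectrum_dilated_iff hα hα' hV hF hθ (σ := 1) (by simp)
      (by simpa using h₁) (by simpa using h₂),
    fun h₁ h₂ => mem_discreteSpectrum_dilated_iff hα hα' hV hF hθ (σ := -1) (by simp)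
      (by simpa using h₁) (by simpa using h₂)⟩
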